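/- Let $\Phi(x)=40x^{12}+508x^{11}+1071x^{10}+930x^9-265x^8-1464x^7-1450x^6-524x^5+58x^4+76x^3+3x^2-6x-1$. For a bounded plane set $S$ and $c>0$, let $cS$ denote the family of all copies of $S$ scaled by $c$ and then moved by an isometry of the plane. A \emph{single fold} of $S$ chooses a line $\ell$ and reflects one or more connected components of $S\setminus\ell$ across $\ell$, leaving the rest of $S$ fixed; let $\mathcal F_1(S)$ be the family of all sets obtained in this way. The \emph{$1$-fold cover factor} of $S$ is $$c_1^*(S)=\inf\{c>0 : \text{every } F\in\mathcal F_1(S) \text{ is contained in some member of } cS\}.$$ Call $F\in\mathcal F_1(S)$ \emph{extremal} if no member of $cS$ with $0<c<c_1^*(S)$ contains $F$. \textbf{Theorem.} The polynomial $\Phi$ has exactly one positive real root $\varrho$, and $\varrho\approx 1.105224$ (precisely, $|\varrho-1.105224|<5\cdot 10^{-7}$). For every (closed, solid) square $S$ of side length $a>0$ in the plane, $$c_1^*(S)=\varrho .$$ Moreover, there is an extremal $F\in\mathcal F_1(S)$; it is unique up to isometries of the plane; and its minimum enclosing squares have side length $\varrho a$ and are, up to translation, exactly three: there are three minimum enclosing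 squares of $F$, no two of which are translates of each other, and every minimum enclosing square of $F$ is a translate of one of them. -/

import Mathlib

open Polynomial
open scoped Pointwise ENNReal

/-- The Euclidean plane. -/
abbrev Plane : Type := EuclideanSpace ℝ (Fin 2)

/-- The family `cS`: all copies of `S` that have been scaled by `c` and then moved by an isometry
of the plane (rotated, reflected, translated). It is used for `c > 0`. -/
def scaledCopies (c : ℝ) (S : Set Plane) : Set (Set Plane) :=
  {T | ∃ g : Plane ≃ᵢ Plane, T = g '' (c • S)}

/-- The connected components of a subset `A` of the plane. -/
def componentsOf (A : Set Plane) : Set (Set Plane) :=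
  {C | ∃ x ∈ A, C = connectedComponentIn A x}

/-- The family of shapes obtained from `S` by a single fold: for a line `ℓ` (through two distinct
points `p`, `q`), one or more connected components of `S \ ℓ` are reflected across `ℓ` and the rest
of `S` stays fixed. -/
noncomputable def singleFolds (S : Set Plane) : Set (Set Plane) :=
  {F | ∃ p q : Plane, p ≠ q ∧
    ∃ 𝒞 : Set (Set Plane), 𝒞.Nonempty ∧ 𝒞 ⊆ componentsOf (S \ (line[ℝ, p, q] : Set Plane)) ∧
      F = (S \ ⋃₀ 𝒞) ∪ EuclideanGeometry.reflection line[ℝ, p, q] '' ⋃₀ 𝒞}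

/-- `F` can be covered by some member of `cS`. -/
def CoveredBy (c : ℝ) (S F : Set Plane) : Prop :=
  ∃ T ∈ scaledCopies c S, F ⊆ T

/-- `cS` is a 1-fold cover of `S`. -/
def IsOneFoldCover (c : ℝ) (S : Set Plane) : Prop :=
  0 < c ∧ ∀ F ∈ singleFolds S, CoveredBy c S F

/-- The 1-fold cover factor of `S`: the infimum of all `c` such that `cS` is a 1-fold cover
of `S` (it is `∞` if there is no such `c`). -/
noncomputable def oneFoldCoverFactor (S : Set Plane) : ℝ≥0∞ :=
  ⨅ (c : ℝ) (_ : IsOneFoldCover c S), ENNReal.ofReal c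

/-- `F` is an extremal single fold of `S`: no `cS` with `c` smaller than the 1-fold cover factor
of `S` covers `F`. -/
def IsExtremalFold (S F : Set Plane) : Prop :=
  F ∈ singleFolds S ∧
    ∀ c : ℝ, 0 < c → CoveredBy c S F → oneFoldCoverFactor S ≤ ENNReal.ofReal c

/-- The (closed, solid) unit square `[0, 1]²`. -/
def unitSquare : Set Plane := {p | ∀ i, p i ∈ Set.Icc (0 : ℝ) 1}

/-- `Q` is a (closed, solid) square of side length `s`, in any position. -/
def IsSquareOfSide (s : ℝ) (Q : Set Plane) : Prop :=
  0 < s ∧ Q ∈ scaledCopies s unitSquare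

/-- `Q` is a minimum enclosing square of `F`, and `s` is its side length. -/
def IsMinEnclosingSquare (s : ℝ) (F Q : Set Plane) : Prop :=
  IsSquareOfSide s Q ∧ F ⊆ Q ∧ ∀ (s' : ℝ) (Q' : Set Plane), IsSquareOfSide s' Q' → F ⊆ Q' → s ≤ s'

/-- `Q'` is a translate of `Q`. -/
def IsTranslateOf (Q' Q : Set Plane) : Prop := ∃ v : Plane, Q' = v +ᵥ Q

/-- The polynomial `Φ` of degree twelve. -/
noncomputable def Phi : ℝ[X] :=
  40 * X ^ 12 + 508 * X ^ 11 + 1071 * X ^ 10 + 930 * X ^ 9 - 265 * X ^ 8 - 1464 * X ^ 7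
    - 1450 * X ^ 6 - 524 * X ^ 5 + 58 * X ^ 4 + 76 * X ^ 3 + 3 * X ^ 2 - 6 * X - 1

/-! A similarity reduces everything to the unit square. A fold that reflects both sides of the line
is a congruent copy of the square. Otherwise one side is reflected, and since reflecting the other
side instead gives a congruent shape, the symmetries of the square bring the line to x + m y = d
with 0 ≤ m ≤ 1 and 2d ≤ 1 + m. If d ≤ m, the reflected part stays inside the square. If t = d - m ≥
0, the extreme points of the fold are among A = (d, 0), B = (1, 0), C = (1, 1), D = (t, 1) and the
mirror images P and R of (0, 0) and (0, 1).

Upper bound. Three enclosing squares compete: the axis-parallel one, whose side is the height of R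
(`halfFold_subset_axis`); one with A, C and B, D on its two pairs of opposite sides
(`halfFold_subset_diag`); and one with a side along CR (`halfFold_subset_flush`). Write q = (t + d)
/ 2. For one pair (m₀, q₀) all three have the same side ρ. If the first square has side at least ρ,
then away from (m₀, q₀) the second is smaller than ρ when q ≥ q₀ (`diag_lt`), and the third when q ≤
q₀ (`flush_lt`). Hence every fold not congruent to the extremal one fits into a square strictly
smaller than ρ (`halfFold_covered`), which yields both the cover factor and the uniqueness.

Lower bound. For the extremal fold, turn the direction of an enclosing square through a right angle.
The projections of the chords BR, BD, AC and AR onto the sides exceed ρ, one chord after the other,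
in all directions except those of the three squares above, where some chord projects to exactly ρ
(`direction_cases`). So no enclosing square is smaller, and those of side ρ have only three
directions; squares with equal side and direction are translates.

The equations for equal sides are solved by taking the positive root ρ of `Phi` and expressing m as
a polynomial in ρ. -/

/-! ### The polynomial `Phi` and the parameters ρ, m, q -/

/-- These are the flush and diagonal equations of `IsExtremalParam` after q has been eliminated by
the height equation. Each power of m is reduced modulo `Phi` to degree 11 in ρ, so that both
equations become linear combinations of the reductions. -/
theorem extremal_slope_equations {ρ m : ℝ} (hρ : 40 * ρ ^ 12 + 508 * ρ ^ 11 + 1071 * ρ ^ 10 + 930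
    * ρ ^ 9 - 265 * ρ ^ 8 - 1464 * ρ ^ 7 - 1450 * ρ ^ 6 - 524 * ρ ^ 5 + 58 * ρ ^ 4 + 76 * ρ ^ 3 +
    3 * ρ ^ 2 - 6 * ρ - 1 = 0) (hm : m = (517661987 + 1755070398 * ρ - 6138329020 * ρ ^ 2 -
    23340384092 * ρ ^ 3 + 30899539102 * ρ ^ 4 + 190635215872 * ρ ^ 5 + 252903206472 * ρ ^ 6 +
    97456999972 * ρ ^ 7 - 117401969477 * ρ ^ 8 - 174918185118 * ρ ^ 9 - 97653438912 * ρ ^ 10 -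
    7928030960 * ρ ^ 11) / 301408) :
    (ρ - 1) * (ρ + 1) ^ 2 * (1 + m ^ 2) ^ 2 - 4 * ρ * (ρ + 1) * m * (1 + m ^ 2)
        - 4 * ρ ^ 2 * (ρ - 1) * (1 + m ^ 2) + 8 * ρ ^ 2 * m = 0 ∧
      (4 * m * (ρ * m ^ 2 + (ρ - 1)) - (ρ * m ^ 2 + (ρ - 1)) ^ 2 + m ^ 4) ^ 2
        - 8 * ρ ^ 2 * m ^ 2 * ((ρ * m ^ 2 + (ρ - 1)) ^ 2 + m ^ 4) = 0 := by
  have h2 : m ^ 2 = (2380837151 + 7846238861 * ρ - 28381972828 * ρ ^ 2 - 104205035984 * ρ ^ 3 +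
      144039854874 * ρ ^ 4 + 858619922806 * ρ ^ 5 + 1129772670996 * ρ ^ 6 + 428583040604 * ρ ^ 7 -
      529502108173 * ρ ^ 8 - 782057197623 * ρ ^ 9 - 433916630964 * ρ ^ 10 - 35189181320 * ρ ^ 11)
      / 602816 := by
    linear_combination m * hm + (517661987 + 1755070398 * ρ - 6138329020 * ρ ^ 2 - 23340384092 * ρ
      ^ 3 + 30899539102 * ρ ^ 4 + 190635215872 * ρ ^ 5 + 252903206472 * ρ ^ 6 + 97456999972 * ρ ^
      7 - 117401969477 * ρ ^ 8 - 174918185118 * ρ ^ 9 - 97653438912 * ρ ^ 10 - 7928030960 * ρ ^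
      11) / 301408 * hm + (-267615131102783865 - 210193212909110318 * ρ + 3728923700083286477 * ρ
      ^ 2 + 2352682406406965236 * ρ ^ 3 - 22146060120943423543 * ρ ^ 4 - 40871727123026108742 * ρ
      ^ 5 - 24196590770624910733 * ρ ^ 6 + 12748801095492124528 * ρ ^ 7 + 27495070352647210228 * ρ
      ^ 8 + 18753932570627105168 * ρ ^ 9 + 1571341872567963040 * ρ ^ 10) / 90846782464 * hρ
  have h3 : m ^ 3 = (3714769247 + 12219622309 * ρ - 44244108260 * ρ ^ 2 - 162310005960 * ρ ^ 3 +
      224401775122 * ρ ^ 4 + 1337537314990 * ρ ^ 5 + 1759918157692 * ρ ^ 6 + 667668771732 * ρ ^ 7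
      - 824841047109 * ρ ^ 8 - 1218256053415 * ρ ^ 9 - 675978431028 * ρ ^ 10 - 54820236040 * ρ ^
      11) / 602816 := by
    linear_combination m * h2 + (2380837151 + 7846238861 * ρ - 28381972828 * ρ ^ 2 - 104205035984
      * ρ ^ 3 + 144039854874 * ρ ^ 4 + 858619922806 * ρ ^ 5 + 1129772670996 * ρ ^ 6 + 428583040604
      * ρ ^ 7 - 529502108173 * ρ ^ 8 - 782057197623 * ρ ^ 9 - 433916630964 * ρ ^ 10 - 35189181320
      * ρ ^ 11) / 602816 * hm + (-1231349229140879261 - 848457938674446267 * ρ +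
      16919293080863184317 * ρ ^ 2 + 9795200343132473645 * ρ ^ 3 - 100173957863087551329 * ρ ^ 4 -
      182967290542872714525 * ρ ^ 5 - 107086337820540248233 * ρ ^ 6 + 57836221477462360223 * ρ ^ 7
      + 123126699167068584214 * ρ ^ 8 + 83334784547995614896 * ρ ^ 9 + 6974522974050341680 * ρ ^
      10) / 181693564928 * hρ
  have h4 : m ^ 4 = (4496945345 + 14974950241 * ρ - 53470277308 * ρ ^ 2 - 199049073576 * ρ ^ 3 +
      270376972390 * ρ ^ 4 + 1634375082774 * ρ ^ 5 + 2157801920700 * ρ ^ 6 + 823964003748 * ρ ^ 7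
      - 1007331216275 * ρ ^ 8 - 1493156848747 * ρ ^ 9 - 830633325428 * ρ ^ 10 - 67392883240 * ρ ^
      11) / 301408 := by
    linear_combination m * h3 + (3714769247 + 12219622309 * ρ - 44244108260 * ρ ^ 2 - 162310005960
      * ρ ^ 3 + 224401775122 * ρ ^ 4 + 1337537314990 * ρ ^ 5 + 1759918157692 * ρ ^ 6 +
      667668771732 * ρ ^ 7 - 824841047109 * ρ ^ 8 - 1218256053415 * ρ ^ 9 - 675978431028 * ρ ^ 10
      - 54820236040 * ρ ^ 11) / 602816 * hm + (-1920283999043422269 - 1314584371811906019 * ρ +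
      26354092972167521557 * ρ ^ 2 + 15255563317094726045 * ρ ^ 3 - 156050652807414398705 * ρ ^ 4
      - 285016549957780577573 * ρ ^ 5 - 166823355570915706161 * ρ ^ 6 + 90096946077976222975 * ρ ^
      7 + 191798622609029351734 * ρ ^ 8 + 129823314701212409392 * ρ ^ 9 + 10865413213990694960 * ρ
      ^ 10) / 181693564928 * hρ
  have h5 : m ^ 5 = (2840741294 + 9434521425 * ρ - 33801030944 * ρ ^ 2 - 125355375596 * ρ ^ 3 +
      171134007020 * ρ ^ 4 + 1030358097394 * ρ ^ 5 + 1359044121400 * ρ ^ 6 + 518003020580 * ρ ^ 7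
      - 635148199286 * ρ ^ 8 - 940533194499 * ρ ^ 9 - 522831581868 * ρ ^ 10 - 42414109640 * ρ ^
      11) / 75352 := by
    linear_combination m * h4 + (4496945345 + 14974950241 * ρ - 53470277308 * ρ ^ 2 - 199049073576
      * ρ ^ 3 + 270376972390 * ρ ^ 4 + 1634375082774 * ρ ^ 5 + 2157801920700 * ρ ^ 6 +
      823964003748 * ρ ^ 7 - 1007331216275 * ρ ^ 8 - 1493156848747 * ρ ^ 9 - 830633325428 * ρ ^ 10
      - 67392883240 * ρ ^ 11) / 301408 * hm + (-2324472774115332707 - 1686206947788924335 * ρ +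
      32104239989614108259 * ρ ^ 2 + 19270718978393764693 * ρ ^ 3 - 190345765231906501067 * ρ ^ 4
      - 349150244240076144225 * ρ ^ 5 - 205331014067673891391 * ρ ^ 6 + 109765897528379001135 * ρ
      ^ 7 + 234923354286667151502 * ρ ^ 8 + 159522853597248424592 * ρ ^ 9 + 13357321620259627760 *
      ρ ^ 10) / 90846782464 * hρ
  have h6 : m ^ 6 = (24508255253 + 81150392571 * ρ - 291713729220 * ρ ^ 2 - 1078109777736 * ρ ^ 3
      + 1477624394478 * ρ ^ 4 + 8868051265554 * ρ ^ 5 + 11687960444508 * ρ ^ 6 + 4448307853052 * ρ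
      ^ 7 - 5467296418655 * ρ ^ 8 - 8089358562201 * ρ ^ 9 - 4494077485292 * ρ ^ 10 - 364537911160
      * ρ ^ 11) / 301408 := by
    linear_combination m * h5 + (2840741294 + 9434521425 * ρ - 33801030944 * ρ ^ 2 - 125355375596
      * ρ ^ 3 + 171134007020 * ρ ^ 4 + 1030358097394 * ρ ^ 5 + 1359044121400 * ρ ^ 6 +
      518003020580 * ρ ^ 7 - 635148199286 * ρ ^ 8 - 940533194499 * ρ ^ 9 - 522831581868 * ρ ^ 10 -
      42414109640 * ρ ^ 11) / 75352 * hm + (-1468697036755167122 - 1051296995823173763 * ρ +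
      20256373943827156230 * ρ ^ 2 + 12036744032910290499 * ρ ^ 3 - 120059153463891510412 * ρ ^ 4
      - 219958908587677247193 * ρ ^ 5 - 129181315680783766410 * ρ ^ 6 + 69256208839681328905 * ρ ^
      7 + 148005048274912317670 * ρ ^ 8 + 100410046954852684352 * ρ ^ 9 + 8406509359168861360 * ρ
      ^ 10) / 22711695616 * hρ
  have h7 : m ^ 7 = (13403177927 + 44439100026 * ρ - 159501378790 * ρ ^ 2 - 590509344374 * ρ ^ 3 +
      807575971560 * ρ ^ 4 + 4855243989238 * ρ ^ 5 + 6401834032070 * ρ ^ 6 + 2438380700090 * ρ ^ 7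
      - 2993190226079 * ρ ^ 8 - 4430526099644 * ρ ^ 9 - 2462170508904 * ρ ^ 10 - 199730597120 * ρ
      ^ 11) / 75352 := by
    linear_combination m * h6 + (24508255253 + 81150392571 * ρ - 291713729220 * ρ ^ 2 -
      1078109777736 * ρ ^ 3 + 1477624394478 * ρ ^ 4 + 8868051265554 * ρ ^ 5 + 11687960444508 * ρ ^
      6 + 4448307853052 * ρ ^ 7 - 5467296418655 * ρ ^ 8 - 8089358562201 * ρ ^ 9 - 4494077485292 *
      ρ ^ 10 - 364537911160 * ρ ^ 11) / 301408 * hm + (-12670832811960682847 - 8943612692495555757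
      * ρ + 174481069117599229663 * ρ ^ 2 + 102821997869943840699 * ρ ^ 3 - 1033736740834538607475
      * ρ ^ 4 - 1892048966196187624187 * ρ ^ 5 - 1110001552192458636595 * ρ ^ 6 +
      596476731389038691609 * ρ ^ 7 + 1273162580143421402410 * ρ ^ 8 + 863092610933085071888 * ρ ^
      9 + 72251696144255237840 * ρ ^ 10) / 90846782464 * hρ
  have h8 : m ^ 8 = (61619724531 + 204459309105 * ρ - 733217375608 * ρ ^ 2 - 2716726318720 * ρ ^ 3
      + 3712417021790 * ρ ^ 4 + 22334237979862 * ρ ^ 5 + 29452950809568 * ρ ^ 6 + 11221646639564 *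
      ρ ^ 7 - 13768002400933 * ρ ^ 8 - 20383161111739 * ρ ^ 9 - 11329296803012 * ρ ^ 10 -
      919055555560 * ρ ^ 11) / 150704 := by
    linear_combination m * h7 + (13403177927 + 44439100026 * ρ - 159501378790 * ρ ^ 2 -
      590509344374 * ρ ^ 3 + 807575971560 * ρ ^ 4 + 4855243989238 * ρ ^ 5 + 6401834032070 * ρ ^ 6
      + 2438380700090 * ρ ^ 7 - 2993190226079 * ρ ^ 8 - 4430526099644 * ρ ^ 9 - 2462170508904 * ρ
      ^ 10 - 199730597120 * ρ ^ 11) / 75352 * hm + (-6929029378839641125 - 4922964529998409938 * ρ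
      + 95487367985902875143 * ρ ^ 2 + 56528771266739476310 * ρ ^ 3 - 565844267131886682639 * ρ ^
      4 - 1036220254076884061366 * ρ ^ 5 - 608266649054202383891 * ρ ^ 6 + 326465456150026808190 *
      ρ ^ 7 + 697252233680730764288 * ρ ^ 8 + 472861753656166399856 * ρ ^ 9 + 39586758940666170880
      * ρ ^ 10) / 22711695616 * hρ
  constructor
  · linear_combination (-4 * ρ + 4 * ρ ^ 2) * hm + (-2 - 2 * ρ + 6 * ρ ^ 2 - 2 * ρ ^ 3) * h2 + (-4
      * ρ - 4 * ρ ^ 2) * h3 + (-1 - 1 * ρ + 1 * ρ ^ 2 + 1 * ρ ^ 3) * h4 + (1719520976 - 517260994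
      * ρ - 201273137 * ρ ^ 2) / 75352 * hρ
  · linear_combination (8 - 24 * ρ + 24 * ρ ^ 2 - 8 * ρ ^ 3) * hm + (16 - 36 * ρ + 20 * ρ ^ 2 + 4
      * ρ ^ 3 - 4 * ρ ^ 4) * h2 + (-24 * ρ + 48 * ρ ^ 2 - 24 * ρ ^ 3) * h3 + (-2 - 28 * ρ + 36 * ρ
      ^ 2 + 4 * ρ ^ 3 - 10 * ρ ^ 4) * h4 + (-8 + 8 * ρ + 24 * ρ ^ 2 - 24 * ρ ^ 3) * h5 + (4 * ρ +
      4 * ρ ^ 2 - 4 * ρ ^ 3 - 4 * ρ ^ 4) * h6 + (8 * ρ - 8 * ρ ^ 3) * h7 + (1 - 2 * ρ ^ 2 + 1 * ρ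
      ^ 4) * h8 + (-23265065738 - 133380145383 * ρ + 152090864514 * ρ ^ 2 + 4554346607 * ρ ^ 3) /
      150704 * hρ

/-- The parameters of the extremal fold: the fold line of the unit square passes through `(q, 1/2)`
and has normal direction `(1, m)`; the minimum enclosing squares have side length `ρ`. -/
structure IsExtremalParam (ρ m q : ℝ) : Prop where
  rho_lb : 1.10522444 < ρ
  rho_ub : ρ < 1.10522445
  m_lb : 0.15481 < m
  m_ub : m < 0.15482
  q_lb : 0.42537 < q
  q_ub : q < 0.42542
  -- With t = q - m/2 and d = q + m/2, the three equations say that the axis-parallel, the diagonal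
  -- and the flush covering square have side ρ; the last two are squared to avoid the lengths of the
  -- direction vectors.
  height : 2 * q * m = ρ * m ^ 2 + (ρ - 1)
  diag : (2 * q - q ^ 2 + m ^ 2 / 4) ^ 2 = 2 * ρ ^ 2 * (q ^ 2 + m ^ 2 / 4)
  flush : (1 - 2 * q + m + m * (2 * q * (1 - q) + m ^ 2 / 2)) ^ 2 =
    ρ ^ 2 * (1 + m ^ 2) * (m ^ 2 + (1 - 2 * q + m) ^ 2)

theorem Phi_isRoot_iff (x : ℝ) : Phi.IsRoot x ↔
    40 * x ^ 12 + 508 * x ^ 11 + 1071 * x ^ 10 + 930 * x ^ 9 - 265 * x ^ 8 - 1464 * x ^ 7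
    - 1450 * x ^ 6 - 524 * x ^ 5 + 58 * x ^ 4 + 76 * x ^ 3 + 3 * x ^ 2 - 6 * x - 1 = 0 := by
  simp [Phi, Polynomial.IsRoot]

theorem Phi_root_gt_one {x : ℝ} (hx : 0 < x)
    (h : 40 * x ^ 12 + 508 * x ^ 11 + 1071 * x ^ 10 + 930 * x ^ 9 - 265 * x ^ 8 - 1464 * x ^ 7
    - 1450 * x ^ 6 - 524 * x ^ 5 + 58 * x ^ 4 + 76 * x ^ 3 + 3 * x ^ 2 - 6 * x - 1 = 0) :
    1 < x := by
  by_contra! hx1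
  have hy : 0 ≤ 1 - x := by linarith
  -- This is -Φ as a form of degree 12 in x and 1 - x. Its only negative coefficient, at x⁵(1 - x)⁷,
  -- is absorbed by the square.
  have key : 1024 * x ^ 12 + 14208 * x ^ 11 * (1 - x) + 41024 * x ^ 10 * (1 - x) ^ 2
      + 53328 * x ^ 9 * (1 - x) ^ 3 + 35884 * x ^ 8 * (1 - x) ^ 4 + 11152 * x ^ 7 * (1 - x) ^ 5
      + x ^ 4 * (1 - x) ^ 6 * (132 * (x - (1 - x)) ^ 2 + 44 * x ^ 2 + 476 * (1 - x) ^ 2)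
      + 444 * x ^ 3 * (1 - x) ^ 9 + 129 * x ^ 2 * (1 - x) ^ 10 + 18 * x * (1 - x) ^ 11
      + (1 - x) ^ 12 = 0 := by
    linear_combination -h
  have : 0 < 1024 * x ^ 12 := by positivity
  have : 0 ≤ 14208 * x ^ 11 * (1 - x) + 41024 * x ^ 10 * (1 - x) ^ 2
      + 53328 * x ^ 9 * (1 - x) ^ 3 + 35884 * x ^ 8 * (1 - x) ^ 4 + 11152 * x ^ 7 * (1 - x) ^ 5
      + x ^ 4 * (1 - x) ^ 6 * (132 * (x - (1 - x)) ^ 2 + 44 * x ^ 2 + 476 * (1 - x) ^ 2)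
      + 444 * x ^ 3 * (1 - x) ^ 9 + 129 * x ^ 2 * (1 - x) ^ 10 + 18 * x * (1 - x) ^ 11
      + (1 - x) ^ 12 := by positivity
  linarith

theorem Phi_root_unique {x y : ℝ} (hx : 0 < x) (hy : 0 < y) (hxr : Phi.IsRoot x)
    (hyr : Phi.IsRoot y) : x = y := by
  rw [Phi_isRoot_iff] at hxr hyr
  obtain ⟨a, rfl⟩ : ∃ a, x = 1 + a := ⟨x - 1, by ring⟩
  obtain ⟨b, rfl⟩ : ∃ b, y = 1 + b := ⟨y - 1, by ring⟩
  have ha : 0 < a := by linarith [Phi_root_gt_one hx hxr]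
  have hb : 0 < b := by linarith [Phi_root_gt_one hy hyr]
  -- Φ(1 + a) = f(a) - 1024, and all coefficients of f are positive.
  let f : ℝ → ℝ := fun a => 1920 * a + 47680 * a ^ 2 + 199248 * a ^ 3 + 435428 * a ^ 4
    + 598640 * a ^ 5 + 555568 * a ^ 6 + 357736 * a ^ 7 + 159920 * a ^ 8 + 48380 * a ^ 9
    + 9299 * a ^ 10 + 988 * a ^ 11 + 40 * a ^ 12
  have hf : ∀ c d : ℝ, 0 < c → c < d → f c < f d := by
    intro c d hc hcd
    simp only [f]
    gcongr
  have e1 : f a = 1024 := by simp only [f]; linear_combination hxr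
  have e2 : f b = 1024 := by simp only [f]; linear_combination hyr
  rcases lt_trichotomy a b with h | h | h
  · linarith [hf a b ha h]
  · rw [h]
  · linarith [hf b a hb h]

/-- The bracket has width 10⁻¹⁷ because m is a polynomial in ρ with huge coefficients that nearly
cancel; a coarser one would not locate m. -/
theorem exists_Phi_root : ∃ ρ : ℝ, Phi.IsRoot ρ ∧
    1.10522444607556434 ≤ ρ ∧ ρ ≤ 1.10522444607556435 := by
  have hc : ContinuousOn (fun x : ℝ => Phi.eval x)
      (Set.Icc 1.10522444607556434 1.10522444607556435) := Phi.continuous.continuousOn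
  have := intermediate_value_Icc (by norm_num) hc
  obtain ⟨ρ, hρ, h⟩ := this (show (0 : ℝ) ∈ _ by
    constructor <;> simp only [Phi] <;> norm_num)
  exact ⟨ρ, h, hρ.1, hρ.2⟩

theorem exists_isExtremalParam : ∃ ρ m q : ℝ, Phi.IsRoot ρ ∧ IsExtremalParam ρ m q := by
  obtain ⟨ρ, hr, hl, hu⟩ := exists_Phi_root
  have h0 := (Phi_isRoot_iff ρ).1 hr
  obtain ⟨m, hm⟩ : ∃ m : ℝ, m = (517661987 + 1755070398 * ρ - 6138329020 * ρ ^ 2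
    - 23340384092 * ρ ^ 3 + 30899539102 * ρ ^ 4 + 190635215872 * ρ ^ 5 + 252903206472 * ρ ^ 6
    + 97456999972 * ρ ^ 7 - 117401969477 * ρ ^ 8 - 174918185118 * ρ ^ 9 - 97653438912 * ρ ^ 10
    - 7928030960 * ρ ^ 11) / 301408 := ⟨_, rfl⟩
  have pl : ∀ k : ℕ, (1.10522444607556434 : ℝ) ^ k ≤ ρ ^ k := fun k =>
    pow_le_pow_left₀ (by norm_num) hl k
  have pu : ∀ k : ℕ, ρ ^ k ≤ (1.10522444607556435 : ℝ) ^ k := fun k =>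
    pow_le_pow_left₀ (by linarith) hu k
  have m1 : (0.154812 : ℝ) < m := by
    rw [hm]
    have := pl 4; have := pl 5; have := pl 6; have := pl 7; have := pu 2; have := pu 3
    have := pu 8; have := pu 9; have := pu 10; have := pu 11
    norm_num at *
    linarith
  have m2 : m < 0.154813 := by
    rw [hm]
    have := pu 4; have := pu 5; have := pu 6; have := pu 7; have := pl 2; have := pl 3
    have := pl 8; have := pl 9; have := pl 10; have := pl 11
    norm_num at *
    linarith
  obtain ⟨e2, e1⟩ := extremal_slope_equations h0 hm
  have hm0 : 0 < m := by linarith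
  have hq : 2 * ((ρ * m ^ 2 + (ρ - 1)) / (2 * m)) * m = ρ * m ^ 2 + (ρ - 1) := by
    field_simp
  have hmm : m ^ 2 < 0.154813 ^ 2 := by gcongr
  have hmm' : 0.154812 ^ 2 < m ^ 2 := by gcongr
  refine ⟨ρ, m, (ρ * m ^ 2 + (ρ - 1)) / (2 * m), hr, ?_, ?_, ?_, ?_, ?_, ?_, hq, ?_, ?_⟩
  · linarith
  · linarith
  · linarith
  · linarith
  · rw [lt_div_iff₀ (by positivity)]
    nlinarith
  · rw [div_lt_iff₀ (by positivity)]
    nlinarith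
  · field_simp
    linear_combination 16 * e1
  · field_simp
    -- Substituting q into the flush equation produces the extra factor (1 + m²)²(ρ - 1), which `e2`
    -- does not contain.
    linear_combination (1 + m ^ 2) ^ 2 * (ρ - 1) * e2

/-! ### Which covering square is smaller than ρ -/

namespace IsExtremalParam

variable {ρ m₀ q₀ m q : ℝ}

theorem rho_sq_bounds (h : IsExtremalParam ρ m₀ q₀) : 1.22152 < ρ ^ 2 ∧ ρ ^ 2 < 1.22153 := by
  have := h.rho_lb; have := h.rho_ub
  constructor <;> nlinarith

theorem q_mul_bounds (h : IsExtremalParam ρ m₀ q₀) :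
    0.4888 < 2 * q₀ * (1 - q₀) ∧ 2 * q₀ * (1 - q₀) < 0.489 := by
  have := h.q_lb; have := h.q_ub
  constructor <;> nlinarith

set_option maxHeartbeats 1000000 in
-- The difference of the two sides vanishes at (m₀, q₀) and decreases in q and in m. Only m < m₀ is
-- delicate: there `hc` forces q up by at least 1.5 (m₀ - m), and the gain from q outweighs the loss
-- from m.
theorem diag_lt (h : IsExtremalParam ρ m₀ q₀) (hm : 0 < m) (hm1 : m ≤ 1) (hq : q₀ ≤ q)
    (hq1 : q ≤ 1 / 2) (hc : ρ * m ^ 2 + (ρ - 1) ≤ 2 * q * m) (hne : ¬ (m = m₀ ∧ q = q₀)) :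
    (2 * q - q ^ 2 + m ^ 2 / 4) ^ 2 < 2 * ρ ^ 2 * (q ^ 2 + m ^ 2 / 4) := by
  obtain ⟨hρ2, hρ2'⟩ := h.rho_sq_bounds
  obtain ⟨rl, ru, ml, mu, ql, qu, h0, h1, -⟩ := h
  have hm₀ : m₀ ^ 2 < 0.15482 ^ 2 := by gcongr
  have hm₀' := sq_nonneg m₀
  have hq₀ : 0 ≤ (q₀ - 0.42537) * (2 - q₀ - 0.42537) := mul_nonneg (by linarith) (by linarith)
  have hq₀' : 0 ≤ (0.42542 - q₀) * (2 - q₀ - 0.42542) := mul_nonneg (by linarith) (by linarith)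
  have hq2 : 0 ≤ (q - q₀) * (2 - q - q₀) := mul_nonneg (by linarith) (by linarith)
  have hq2' : 0 ≤ (1 / 2 - q) * (2 - q - 1 / 2) := mul_nonneg (by linarith) (by linarith)
  have hX0 : 2 * q₀ - q₀ ^ 2 + m₀ ^ 2 / 4 < 0.677 := by linarith
  have hX0' : 0.65 < 2 * q₀ - q₀ ^ 2 + m₀ ^ 2 / 4 := by linarith
  have hXq : 2 * q - q ^ 2 ≤ 0.75 := by linarith
  have hXq' : 0.65 < 2 * q - q ^ 2 := by linarith
  have hM : m ^ 2 ≤ 1 := pow_le_one₀ hm.le hm1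
  -- Y is the sum of the two bases, so that the difference of their squares factors.
  obtain ⟨Y, hY⟩ : ∃ Y, Y = (2 * q - q ^ 2 + m ^ 2 / 4) + (2 * q₀ - q₀ ^ 2 + m₀ ^ 2 / 4) :=
    ⟨_, rfl⟩
  have key : (2 * q - q ^ 2 + m ^ 2 / 4) ^ 2 - 2 * ρ ^ 2 * (q ^ 2 + m ^ 2 / 4) =
      (q - q₀) * (Y * (2 - (q + q₀)) - 2 * ρ ^ 2 * (q + q₀))
        + (m - m₀) * ((m + m₀) * (Y - 2 * ρ ^ 2)) / 4 := by
    rw [hY]; linear_combination h1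
  have hYu : Y ≤ 1.677 := by linarith
  have hYl : 1.3 < Y := by linarith [sq_nonneg m]
  have hA : Y * (2 - (q + q₀)) - 2 * ρ ^ 2 * (q + q₀) < -0.14 := by
    have a1 : Y * (2 - (q + q₀)) ≤ 1.677 * 1.14926 :=
      mul_le_mul hYu (by linarith) (by linarith) (by norm_num)
    have a2 : 2.443 * 0.85074 ≤ 2 * ρ ^ 2 * (q + q₀) :=
      mul_le_mul (by linarith) (by linarith) (by norm_num) (by linarith)
    linarith
  have hB : Y - 2 * ρ ^ 2 < 0 := by linarith
  rcases le_or_gt m₀ m with hmm | hmm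
  · have e1 : (q - q₀) * (Y * (2 - (q + q₀)) - 2 * ρ ^ 2 * (q + q₀)) ≤ 0 :=
      mul_nonpos_of_nonneg_of_nonpos (by linarith) (by linarith)
    have hB' : (m + m₀) * (Y - 2 * ρ ^ 2) < 0 := mul_neg_of_pos_of_neg (by linarith) hB
    have e2 : (m - m₀) * ((m + m₀) * (Y - 2 * ρ ^ 2)) ≤ 0 :=
      mul_nonpos_of_nonneg_of_nonpos (by linarith) hB'.le
    rcases hmm.eq_or_lt with he | hlt
    · have : q₀ < q := lt_of_le_of_ne hq fun e => hne ⟨he.symm, e.symm⟩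
      have : (q - q₀) * (Y * (2 - (q + q₀)) - 2 * ρ ^ 2 * (q + q₀)) < 0 :=
        mul_neg_of_pos_of_neg (by linarith) (by linarith)
      linarith
    · have : (m - m₀) * ((m + m₀) * (Y - 2 * ρ ^ 2)) < 0 :=
        mul_neg_of_pos_of_neg (by linarith) hB'
      linarith
  · have hmm0 : m * m₀ < 0.15482 * 0.15482 :=
      mul_lt_mul'' (hmm.trans mu) mu hm.le (by linarith)
    have hmm1 : ρ * (m * m₀) < 1.10523 * (0.15482 * 0.15482) :=
      mul_lt_mul'' (by linarith) hmm0 (by linarith) (mul_pos hm (by linarith)).le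
    -- Combine `hc` times m₀ with the equation `h0` times m; here m m₀ < 0.024 is small against ρ -
    -- 1.
    have hq2 : 1.5 * (m₀ - m) ≤ q - q₀ := by
      have e : (m₀ - m) * ((ρ - 1) - ρ * (m * m₀)) ≤ 2 * (m * m₀) * (q - q₀) := by
        have := mul_le_mul_of_nonneg_left hc (show (0 : ℝ) ≤ m₀ by linarith)
        linear_combination this + m * h0
      have e2 : 0.078 ≤ (ρ - 1) - ρ * (m * m₀) := by linarith
      have e3 : (m₀ - m) * 0.078 ≤ 2 * (m * m₀) * (q - q₀) :=
        le_trans (mul_le_mul_of_nonneg_left e2 (by linarith)) e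
      have e4 : 2 * (m * m₀) * (q - q₀) ≤ 0.048 * (q - q₀) :=
        mul_le_mul_of_nonneg_right (by linarith) (by linarith)
      linarith
    have e1 : (q - q₀) * (Y * (2 - (q + q₀)) - 2 * ρ ^ 2 * (q + q₀)) ≤
        (1.5 * (m₀ - m)) * (-0.14) := by
      have a1 := mul_le_mul_of_nonneg_left hA.le (sub_nonneg.2 hq)
      have a2 := mul_le_mul_of_nonpos_right hq2 (show (-0.14 : ℝ) ≤ 0 by norm_num)
      linarith
    have e2 : (m - m₀) * ((m + m₀) * (Y - 2 * ρ ^ 2)) ≤ (m₀ - m) * (0.31 * 1.15) := by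
      have : (m + m₀) * (2 * ρ ^ 2 - Y) ≤ 0.31 * 1.15 :=
        mul_le_mul (by linarith) (by linarith) (by linarith) (by norm_num)
      have := mul_le_mul_of_nonneg_left this (show 0 ≤ m₀ - m by linarith)
      linarith
    linarith

set_option maxHeartbeats 1000000 in
-- For fixed q = q₀ the difference of the sides is a polynomial in m vanishing at m₀. Its divided
-- difference H is positive, the only harmful high power m⁵ being controlled by m ≤ 0.62.
theorem flush_of_eq (h : IsExtremalParam ρ m₀ q₀) (hm : m₀ < m) (hm1 : m ≤ 0.62) :
    (1 - 2 * q₀ + m + m * (2 * q₀ * (1 - q₀) + m ^ 2 / 2)) ^ 2 <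
      ρ ^ 2 * (1 + m ^ 2) * (m ^ 2 + (1 - 2 * q₀ + m) ^ 2) := by
  obtain ⟨hρ2, hρ2'⟩ := h.rho_sq_bounds
  obtain ⟨hql, hqu⟩ := h.q_mul_bounds
  obtain ⟨rl, ru, ml, mu, ql, qu, -, -, h2⟩ := h
  obtain ⟨c, hc⟩ : ∃ c, c = 1 - 2 * q₀ := ⟨_, rfl⟩
  obtain ⟨b, hb⟩ : ∃ b, b = 1 + 2 * q₀ * (1 - q₀) := ⟨_, rfl⟩
  have hcl : 0.149 < c := by linarith
  have hcu : c < 0.1493 := by linarith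
  have hbl : 1.4888 < b := by linarith
  have hbu : b < 1.489 := by linarith
  obtain ⟨H, hH⟩ : ∃ H, H = 2 * c * (ρ ^ 2 - b) + (ρ ^ 2 * (2 + c ^ 2) - b ^ 2) * (m + m₀)
      + (2 * c * ρ ^ 2 - c) * (m ^ 2 + m * m₀ + m₀ ^ 2)
      + (2 * ρ ^ 2 - b) * (m ^ 3 + m ^ 2 * m₀ + m * m₀ ^ 2 + m₀ ^ 3)
      - (m ^ 5 + m ^ 4 * m₀ + m ^ 3 * m₀ ^ 2 + m ^ 2 * m₀ ^ 3 + m * m₀ ^ 4 + m₀ ^ 5) / 4 :=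
    ⟨_, rfl⟩
  have key : ρ ^ 2 * (1 + m ^ 2) * (m ^ 2 + (1 - 2 * q₀ + m) ^ 2)
      - (1 - 2 * q₀ + m + m * (2 * q₀ * (1 - q₀) + m ^ 2 / 2)) ^ 2 = (m - m₀) * H := by
    rw [hH, hc, hb]; linear_combination -h2
  have hp1 : -0.07995 ≤ 2 * c * (ρ ^ 2 - b) := by
    have : 2 * c * (b - ρ ^ 2) ≤ 0.2986 * 0.26748 :=
      mul_le_mul (by linarith) (by linarith) (by linarith) (by norm_num)
    linarith
  have hp2 : 0.25 ≤ ρ ^ 2 * (2 + c ^ 2) - b ^ 2 := by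
    have a1 : (0.149 : ℝ) ^ 2 ≤ c ^ 2 := by gcongr
    have a2 : b ^ 2 ≤ 1.489 ^ 2 := by gcongr
    have a3 : 1.22152 * 2.0222 ≤ ρ ^ 2 * (2 + c ^ 2) :=
      mul_le_mul hρ2.le (by linarith) (by norm_num) (by positivity)
    linarith
  have hp3 : 0.21 ≤ 2 * c * ρ ^ 2 - c := by
    have : 0.149 * 1.44 ≤ c * (2 * ρ ^ 2 - 1) :=
      mul_le_mul hcl.le (by linarith) (by norm_num) (by linarith)
    linarith
  have hp4 : 0.9 ≤ 2 * ρ ^ 2 - b := by linarith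
  have e2 : 0.25 * 0.3096 ≤ (ρ ^ 2 * (2 + c ^ 2) - b ^ 2) * (m + m₀) :=
    mul_le_mul hp2 (by linarith) (by norm_num) (by linarith)
  have hmm : 0.07 ≤ m ^ 2 + m * m₀ + m₀ ^ 2 := by
    have a1 : (0.15481 : ℝ) ^ 2 ≤ m ^ 2 := by gcongr; linarith
    have a2 : (0.15481 : ℝ) ^ 2 ≤ m₀ ^ 2 := by gcongr
    have a3 : (0.15481 : ℝ) * 0.15481 ≤ m * m₀ :=
      mul_le_mul (by linarith) ml.le (by norm_num) (by linarith)
    linarith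
  have e3 : 0.21 * 0.07 ≤ (2 * c * ρ ^ 2 - c) * (m ^ 2 + m * m₀ + m₀ ^ 2) :=
    mul_le_mul hp3 hmm (by norm_num) (by linarith)
  have hm0 : 0 < m := by linarith
  have hm00 : 0 < m₀ := by linarith
  have hle := hm.le
  have hm3 : m ^ 3 + m ^ 2 * m₀ + m * m₀ ^ 2 + m₀ ^ 3 ≥ m ^ 3 := by
    have : 0 ≤ m ^ 2 * m₀ + m * m₀ ^ 2 + m₀ ^ 3 := by positivity
    linarith
  have e4 : 0.9 * m ^ 3 ≤ (2 * ρ ^ 2 - b) * (m ^ 3 + m ^ 2 * m₀ + m * m₀ ^ 2 + m₀ ^ 3) :=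
    mul_le_mul hp4 hm3 (by positivity) (by linarith)
  have e5 : m ^ 5 + m ^ 4 * m₀ + m ^ 3 * m₀ ^ 2 + m ^ 2 * m₀ ^ 3 + m * m₀ ^ 4 + m₀ ^ 5 ≤
      6 * m ^ 5 := by
    have a1 : m ^ 4 * m₀ ≤ m ^ 4 * m := by gcongr
    have a2 : m ^ 3 * m₀ ^ 2 ≤ m ^ 3 * m ^ 2 := by gcongr
    have a3 : m ^ 2 * m₀ ^ 3 ≤ m ^ 2 * m ^ 3 := by gcongr
    have a4 : m * m₀ ^ 4 ≤ m * m ^ 4 := by gcongr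
    have a5 : m₀ ^ 5 ≤ m ^ 5 := by gcongr
    linarith
  have e6 : m ^ 5 ≤ 0.3844 * m ^ 3 := by
    have : m ^ 2 ≤ 0.62 ^ 2 := by gcongr
    have := mul_le_mul_of_nonneg_left this (show 0 ≤ m ^ 3 by positivity)
    linarith
  have hm3' : 0 < m ^ 3 := by positivity
  have hHpos : 0 < H := by rw [hH]; linarith
  have := mul_pos (sub_pos.2 hm) hHpos
  linarith

set_option maxHeartbeats 1000000 in
-- The height condition confines m to an interval starting at m₀. There the inequality is first
-- obtained at q = q₀ from `flush_of_eq`, and then lowering q only enlarges the difference.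
theorem flush_lt (h : IsExtremalParam ρ m₀ q₀) (hm : 0 < m) (hq : q ≤ q₀)
    (hc : ρ * m ^ 2 + (ρ - 1) ≤ 2 * q * m) (hne : ¬ (m = m₀ ∧ q = q₀)) :
    (1 - 2 * q + m + m * (2 * q * (1 - q) + m ^ 2 / 2)) ^ 2 <
      ρ ^ 2 * (1 + m ^ 2) * (m ^ 2 + (1 - 2 * q + m) ^ 2) := by
  have hh := h
  obtain ⟨hρ2, hρ2'⟩ := h.rho_sq_bounds
  obtain ⟨hqql, hqqu⟩ := h.q_mul_bounds
  obtain ⟨rl, ru, ml, mu, ql, qu, h0, -, h2⟩ := h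
  have hm0 : 0 < m₀ := by linarith
  -- So m lies between m₀ and (ρ - 1)/(ρ m₀) ≈ 0.615, the other slope at which q₀ meets the height
  -- condition with equality.
  have hprod : (m - m₀) * (ρ * (m * m₀) - (ρ - 1)) ≤ 0 := by
    have := mul_le_mul_of_nonneg_left hc hm0.le
    have : 0 ≤ (q₀ - q) * (m * m₀) := mul_nonneg (by linarith) (by positivity)
    linarith [show m * (2 * q₀ * m₀) = m * (ρ * m₀ ^ 2 + (ρ - 1)) by rw [h0]]
  have hmm : m₀ ≤ m := by
    by_contra! hlt
    have e1 : m * m₀ < 0.15482 * 0.15482 :=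
      mul_lt_mul'' (hlt.trans mu) mu hm.le (by linarith)
    have e2 : ρ * (m * m₀) < 1.10523 * (0.15482 * 0.15482) :=
      mul_lt_mul'' (by linarith) e1 (by linarith) (by positivity)
    have := mul_pos_of_neg_of_neg (sub_neg.2 hlt)
      (show ρ * (m * m₀) - (ρ - 1) < 0 by linarith)
    linarith
  have hm1 : m ≤ 0.62 := by
    by_contra! hlt
    have e1 : 0.62 * 0.15481 < m * m₀ := mul_lt_mul'' hlt ml (by norm_num) (by norm_num)
    have e2 : 1.10522444 * (0.62 * 0.15481) < ρ * (m * m₀) :=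
      mul_lt_mul'' rl e1 (by norm_num) (by norm_num)
    have := mul_pos (show 0 < m - m₀ by linarith)
      (show 0 < ρ * (m * m₀) - (ρ - 1) by linarith)
    linarith
  -- By the arithmetic–geometric mean inequality the height condition gives q ≥ √(ρ(ρ - 1)) ≈ 0.341.
  have hql : 0.34 ≤ q := by
    by_contra! hlt
    have e1 : q * m < 0.34 * m := mul_lt_mul_of_pos_right hlt hm
    have e2 : 1.105 * m ^ 2 ≤ ρ * m ^ 2 :=
      mul_le_mul_of_nonneg_right (by linarith) (by positivity)
    linarith [sq_nonneg (m - 0.308)]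
  have hat : (1 - 2 * q₀ + m + m * (2 * q₀ * (1 - q₀) + m ^ 2 / 2)) ^ 2 ≤
      ρ ^ 2 * (1 + m ^ 2) * (m ^ 2 + (1 - 2 * q₀ + m) ^ 2) := by
    rcases hmm.eq_or_lt with he | hlt
    · rw [← he]; exact h2.le
    · exact (hh.flush_of_eq hlt hm1).le
  rcases hq.eq_or_lt with he | hlt
  · rw [he]
    exact hh.flush_of_eq (lt_of_le_of_ne hmm fun e => hne ⟨e.symm, he⟩) hm1
  obtain ⟨c, hcd⟩ : ∃ c, c = 1 - 2 * q₀ := ⟨_, rfl⟩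
  obtain ⟨b, hbd⟩ : ∃ b, b = 2 * q₀ * (1 - q₀) := ⟨_, rfl⟩
  obtain ⟨σ, hσ⟩ : ∃ σ, σ = 1 - q - q₀ := ⟨_, rfl⟩
  obtain ⟨N, hN⟩ : ∃ N, N = c + m + m * (b + m ^ 2 / 2) := ⟨_, rfl⟩
  -- The change from q₀ to q, factored by q₀ - q; `f2` and `f3` make the other factor positive.
  have key : (ρ ^ 2 * (1 + m ^ 2) * (m ^ 2 + (1 - 2 * q + m) ^ 2)
      - (1 - 2 * q + m + m * (2 * q * (1 - q) + m ^ 2 / 2)) ^ 2)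
      - (ρ ^ 2 * (1 + m ^ 2) * (m ^ 2 + (1 - 2 * q₀ + m) ^ 2)
      - (1 - 2 * q₀ + m + m * (2 * q₀ * (1 - q₀) + m ^ 2 / 2)) ^ 2) =
      4 * (q₀ - q) * ((ρ ^ 2 * (1 + m ^ 2) * (c + m) - (1 - m * σ) * N)
        + (q₀ - q) * (ρ ^ 2 * (1 + m ^ 2) - (1 - m * σ) ^ 2)) := by
    rw [hN, hσ, hcd, hbd]; ring
  have hcl : 0.149 < c := by linarith
  have hcu : c < 0.1493 := by linarith
  have hbu : b < 0.489 := by linarith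
  have hbl : 0.488 < b := by linarith
  have hσc : c ≤ σ := by linarith
  have hmσ : m * c ≤ m * σ := mul_le_mul_of_nonneg_left hσc hm.le
  have hmσ1 : m * σ ≤ 0.62 * 1 :=
    mul_le_mul hm1 (by linarith) (by linarith) (by norm_num)
  have hNpos : 0 ≤ N := by rw [hN]; positivity
  have f1 : (1 - m * σ) * N ≤ (1 - m * c) * N := mul_le_mul_of_nonneg_right (by linarith) hNpos
  have f2 : 0 < ρ ^ 2 * (1 + m ^ 2) * (c + m) - (1 - m * c) * N := by
    have e : ρ ^ 2 * (1 + m ^ 2) * (c + m) - (1 - m * c) * N =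
        (ρ ^ 2 - 1) * c + (ρ ^ 2 - 1 - b + c ^ 2) * m + c * (ρ ^ 2 + 1 + b) * m ^ 2
          + (ρ ^ 2 - 1 / 2) * m ^ 3 + c / 2 * m ^ 4 := by
      rw [hN]; ring
    have a0 : 0.2215 * 0.149 ≤ (ρ ^ 2 - 1) * c :=
      mul_le_mul (by linarith) hcl.le (by norm_num) (by linarith)
    have c2 : (0.149 : ℝ) ^ 2 ≤ c ^ 2 := by gcongr
    have c3 : 0.149 * 2.7 ≤ c * (ρ ^ 2 + 1 + b) :=
      mul_le_mul hcl.le (by linarith) (by norm_num) (by linarith)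
    have a1 : -0.246 * m ≤ (ρ ^ 2 - 1 - b + c ^ 2) * m :=
      mul_le_mul_of_nonneg_right (by linarith) hm.le
    have a2 : 0.4 * m ^ 2 ≤ c * (ρ ^ 2 + 1 + b) * m ^ 2 :=
      mul_le_mul_of_nonneg_right (by linarith) (by positivity)
    have a3 : 0.72 * m ^ 3 ≤ (ρ ^ 2 - 1 / 2) * m ^ 3 :=
      mul_le_mul_of_nonneg_right (by linarith) (by positivity)
    have a4 : 0 ≤ c / 2 * m ^ 4 := by positivity
    -- The tangent of m³ at 0.2 replaces the cube and leaves a quadratic with minimum at 0.1995.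
    have a5 : 0.12 * m - 0.016 ≤ m ^ 3 := by
      have : 0 ≤ (m - 0.2) ^ 2 * (m + 0.4) := by positivity
      linarith
    have a6 : 0 < 0.02148 - 0.1596 * m + 0.4 * m ^ 2 := by linarith [sq_nonneg (m - 0.1995)]
    linarith
  have f3 : 0 ≤ ρ ^ 2 * (1 + m ^ 2) - (1 - m * σ) ^ 2 := by
    have a1 : (1 - m * σ) ^ 2 ≤ 1 := by
      have : 0 ≤ m * σ := mul_nonneg hm.le (by linarith)
      exact pow_le_one₀ (by linarith) (by linarith)
    have a2 : 0 ≤ ρ ^ 2 * m ^ 2 := by positivity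
    linarith
  have f4 : 0 ≤ (q₀ - q) * (ρ ^ 2 * (1 + m ^ 2) - (1 - m * σ) ^ 2) :=
    mul_nonneg (by linarith) f3
  have := mul_pos (show 0 < 4 * (q₀ - q) by linarith)
    (show 0 < (ρ ^ 2 * (1 + m ^ 2) * (c + m) - (1 - m * σ) * N)
      + (q₀ - q) * (ρ ^ 2 * (1 + m ^ 2) - (1 - m * σ) ^ 2) by linarith)
  linarith

end IsExtremalParam

/-! ### Similarities and squares in coordinates -/

/-- The similarity of the plane with ratio `κ`, rotation part `(c, s)`, orientation `ε` and
translation part `(b₀, b₁)`. -/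
noncomputable def simMap (κ c s ε b₀ b₁ : ℝ) (x : Plane) : Plane :=
  !₂[κ * (c * x 0 - ε * s * x 1) + b₀, κ * (s * x 0 + ε * c * x 1) + b₁]

@[simp] theorem simMap_zero (κ c s ε b₀ b₁ : ℝ) (x : Plane) :
    simMap κ c s ε b₀ b₁ x 0 = κ * (c * x 0 - ε * s * x 1) + b₀ := rfl

@[simp] theorem simMap_one (κ c s ε b₀ b₁ : ℝ) (x : Plane) :
    simMap κ c s ε b₀ b₁ x 1 = κ * (s * x 0 + ε * c * x 1) + b₁ := rfl

theorem plane_ext {x y : Plane} (h0 : x 0 = y 0) (h1 : x 1 = y 1) : x = y := by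
  ext i; fin_cases i <;> assumption

/-- A surjective isometry of a real normed space is affine. The images of the two basis vectors are
orthonormal; the first is (c, s), and ε is the determinant. -/
theorem isometryEquiv_eq_simMap (g : Plane ≃ᵢ Plane) : ∃ c s ε b₀ b₁ : ℝ,
    c ^ 2 + s ^ 2 = 1 ∧ ε ^ 2 = 1 ∧ ∀ x, g x = simMap 1 c s ε b₀ b₁ x := by
  let A := g.toRealAffineIsometryEquiv
  let L := A.linearIsometryEquiv
  have hg : ∀ x, g x = L x + g 0 := by
    intro x
    have := A.map_vadd 0 x
    simpa [A, L] using this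
  obtain ⟨u, hu⟩ : ∃ u, u = L !₂[1, 0] := ⟨_, rfl⟩
  obtain ⟨w, hw⟩ : ∃ w, w = L !₂[0, 1] := ⟨_, rfl⟩
  have hL : ∀ x : Plane, L x = x 0 • u + x 1 • w := by
    intro x
    rw [hu, hw, ← map_smul, ← map_smul, ← map_add]
    congr 1
    apply plane_ext <;> simp
  have h1 : u 0 ^ 2 + u 1 ^ 2 = 1 := by
    have h := EuclideanSpace.real_norm_sq_eq u
    rw [hu, L.norm_map, ← hu, EuclideanSpace.real_norm_sq_eq] at h
    simpa [Fin.sum_univ_two] using h.symm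
  have h2 : w 0 ^ 2 + w 1 ^ 2 = 1 := by
    have h := EuclideanSpace.real_norm_sq_eq w
    rw [hw, L.norm_map, ← hw, EuclideanSpace.real_norm_sq_eq] at h
    simpa [Fin.sum_univ_two] using h.symm
  have h3 : u 0 * w 0 + u 1 * w 1 = 0 := by
    have h := L.inner_map_map !₂[1, 0] !₂[0, 1]
    rw [← hu, ← hw] at h
    simp [PiLp.inner_apply, Fin.sum_univ_two] at h
    linarith
  refine ⟨u 0, u 1, u 0 * w 1 - u 1 * w 0, g 0 0, g 0 1, h1, ?_, fun x => ?_⟩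
  · linear_combination (w 0 ^ 2 + w 1 ^ 2) * h1 + h2 - (u 0 * w 0 + u 1 * w 1) * h3
  · rw [hg, hL]
    apply plane_ext
    · simp
      linear_combination x 1 * (-w 0 * h1 + u 0 * h3)
    · simp
      linear_combination x 1 * (-w 1 * h1 + u 1 * h3)

theorem exists_isometryEquiv_eq_simMap {c s ε : ℝ} (b₀ b₁ : ℝ) (h : c ^ 2 + s ^ 2 = 1)
    (hε : ε ^ 2 = 1) : ∃ g : Plane ≃ᵢ Plane, ∀ x, g x = simMap 1 c s ε b₀ b₁ x := by
  refine ⟨IsometryEquiv.mk' (simMap 1 c s ε b₀ b₁)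
    (fun y => !₂[c * (y 0 - b₀) + s * (y 1 - b₁), ε * (c * (y 1 - b₁) - s * (y 0 - b₀))])
    (fun y => ?_) (Isometry.of_dist_eq fun x y => ?_), fun x => rfl⟩
  · apply plane_ext
    · simp
      linear_combination (y 0 - b₀) * h + (-s * c * (y 1 - b₁) + s ^ 2 * (y 0 - b₀)) * hε
    · simp
      linear_combination (y 1 - b₁) * h + (c ^ 2 * (y 1 - b₁) - s * c * (y 0 - b₀)) * hε
  · rw [EuclideanSpace.dist_eq, EuclideanSpace.dist_eq]
    congr 1
    simp only [Fin.sum_univ_two, Real.dist_eq, sq_abs, simMap_zero, simMap_one]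
    linear_combination ((x 0 - y 0) ^ 2 + (x 1 - y 1) ^ 2 * ε ^ 2) * h + (x 1 - y 1) ^ 2 * hε

theorem mem_scaledCopies_iff_simMap {κ : ℝ} {S T : Set Plane} : T ∈ scaledCopies κ S ↔
    ∃ c s ε b₀ b₁ : ℝ, c ^ 2 + s ^ 2 = 1 ∧ ε ^ 2 = 1 ∧ T = simMap κ c s ε b₀ b₁ '' S := by
  have key : ∀ c s ε b₀ b₁ : ℝ, ∀ x : Plane,
      simMap 1 c s ε b₀ b₁ (κ • x) = simMap κ c s ε b₀ b₁ x := by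
    intro c s ε b₀ b₁ x
    apply plane_ext <;> simp <;> ring
  constructor
  · rintro ⟨g, rfl⟩
    obtain ⟨c, s, ε, b₀, b₁, h, hε, hg⟩ := isometryEquiv_eq_simMap g
    refine ⟨c, s, ε, b₀, b₁, h, hε, ?_⟩
    rw [← Set.image_smul, Set.image_image]
    exact Set.image_congr fun x _ => by rw [hg, key]
  · rintro ⟨c, s, ε, b₀, b₁, h, hε, rfl⟩
    obtain ⟨g, hg⟩ := exists_isometryEquiv_eq_simMap b₀ b₁ h hε
    refine ⟨g, ?_⟩
    rw [← Set.image_smul, Set.image_image]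
    exact Set.image_congr fun x _ => by rw [hg, key]

/-- The closed square of side `ℓ` with sides in the directions `(c, s)` and `(-s, c)`, whose
coordinates in these directions start at `α` and `β`. -/
def tiltedSquare (c s α β ℓ : ℝ) : Set Plane :=
  {p | α ≤ c * p 0 + s * p 1 ∧ c * p 0 + s * p 1 ≤ α + ℓ ∧
    β ≤ -s * p 0 + c * p 1 ∧ -s * p 0 + c * p 1 ≤ β + ℓ}

theorem mem_unitSquare {p : Plane} :
    p ∈ unitSquare ↔ 0 ≤ p 0 ∧ p 0 ≤ 1 ∧ 0 ≤ p 1 ∧ p 1 ≤ 1 := by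
  simp [unitSquare, Fin.forall_fin_two, and_assoc]

theorem simMap_image_unitSquare_pos {κ c s : ℝ} (b₀ b₁ : ℝ) (hκ : 0 < κ)
    (h : c ^ 2 + s ^ 2 = 1) : simMap κ c s 1 b₀ b₁ '' unitSquare =
      tiltedSquare c s (c * b₀ + s * b₁) (-s * b₀ + c * b₁) κ := by
  ext p
  constructor
  · rintro ⟨x, hx, rfl⟩
    obtain ⟨h1, h2, h3, h4⟩ := mem_unitSquare.1 hx
    have e0 : c * simMap κ c s 1 b₀ b₁ x 0 + s * simMap κ c s 1 b₀ b₁ x 1 =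
        (c * b₀ + s * b₁) + κ * x 0 := by
      simp; linear_combination κ * x 0 * h
    have e1 : -s * simMap κ c s 1 b₀ b₁ x 0 + c * simMap κ c s 1 b₀ b₁ x 1 =
        (-s * b₀ + c * b₁) + κ * x 1 := by
      simp; linear_combination κ * x 1 * h
    refine ⟨?_, ?_, ?_, ?_⟩
    · rw [e0]; nlinarith
    · rw [e0]; nlinarith
    · rw [e1]; nlinarith
    · rw [e1]; nlinarith
  · rintro ⟨h1, h2, h3, h4⟩
    refine ⟨!₂[(c * (p 0 - b₀) + s * (p 1 - b₁)) / κ, (c * (p 1 - b₁) - s * (p 0 - b₀)) / κ],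
      mem_unitSquare.2 ⟨?_, ?_, ?_, ?_⟩, plane_ext ?_ ?_⟩
    · exact div_nonneg (by linarith) hκ.le
    · exact (div_le_one hκ).2 (by linarith)
    · exact div_nonneg (by linarith) hκ.le
    · exact (div_le_one hκ).2 (by linarith)
    · simp; field_simp; linear_combination (p 0 - b₀) * h
    · simp; field_simp; linear_combination (p 1 - b₁) * h

/-- The square is symmetric about its horizontal midline, so orientation-reversing similarities give
no new images. -/
theorem simMap_neg_image_unitSquare (κ c s b₀ b₁ : ℝ) :
    simMap κ c s (-1) b₀ b₁ '' unitSquare =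
      simMap κ c s 1 (b₀ + κ * s) (b₁ - κ * c) '' unitSquare := by
  have key : ∀ κ c s b₀ b₁ ε : ℝ, ε ^ 2 = 1 →
      simMap κ c s ε b₀ b₁ '' unitSquare ⊆
        simMap κ c s (-ε) (b₀ - ε * κ * s) (b₁ + ε * κ * c) '' unitSquare := by
    rintro κ c s b₀ b₁ ε hε _ ⟨x, hx, rfl⟩
    obtain ⟨h1, h2, h3, h4⟩ := mem_unitSquare.1 hx
    refine ⟨!₂[x 0, 1 - x 1], mem_unitSquare.2 ⟨h1, h2, ?_, ?_⟩, plane_ext ?_ ?_⟩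
    · simpa using h4
    · simpa using h3
    · simp; ring
    · simp; ring
  apply Set.Subset.antisymm
  · have := key κ c s b₀ b₁ (-1) (by norm_num)
    convert this using 3 <;> ring
  · have := key κ c s (b₀ + κ * s) (b₁ - κ * c) 1 (by norm_num)
    convert this using 3 <;> ring

theorem mem_scaledCopies_unitSquare {ℓ : ℝ} (hℓ : 0 < ℓ) {Q : Set Plane} :
    Q ∈ scaledCopies ℓ unitSquare ↔
      ∃ c s α β : ℝ, c ^ 2 + s ^ 2 = 1 ∧ Q = tiltedSquare c s α β ℓ := by
  rw [mem_scaledCopies_iff_simMap]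
  constructor
  · rintro ⟨c, s, ε, b₀, b₁, h, hε, rfl⟩
    rcases sq_eq_sq_iff_eq_or_eq_neg.1 (hε.trans (one_pow 2).symm) with rfl | rfl
    · exact ⟨c, s, _, _, h, simMap_image_unitSquare_pos _ _ hℓ h⟩
    · rw [simMap_neg_image_unitSquare]
      exact ⟨c, s, _, _, h, simMap_image_unitSquare_pos _ _ hℓ h⟩
  · rintro ⟨c, s, α, β, h, rfl⟩
    refine ⟨c, s, 1, c * α - s * β, s * α + c * β, h, by norm_num, ?_⟩
    rw [simMap_image_unitSquare_pos _ _ hℓ h]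
    congr 1
    · linear_combination -α * h
    · linear_combination -β * h

/-! ### Half-folds and linear functions on them -/

/-- The reflection across the line `a x + b y = d`. -/
noncomputable def mirror (a b d : ℝ) (p : Plane) : Plane :=
  !₂[p 0 - 2 * (a * p 0 + b * p 1 - d) / (a ^ 2 + b ^ 2) * a,
    p 1 - 2 * (a * p 0 + b * p 1 - d) / (a ^ 2 + b ^ 2) * b]

@[simp] theorem mirror_zero (a b d : ℝ) (p : Plane) :
    mirror a b d p 0 = p 0 - 2 * (a * p 0 + b * p 1 - d) / (a ^ 2 + b ^ 2) * a := rfl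

@[simp] theorem mirror_one (a b d : ℝ) (p : Plane) :
    mirror a b d p 1 = p 1 - 2 * (a * p 0 + b * p 1 - d) / (a ^ 2 + b ^ 2) * b := rfl

/-- The part of `S` where `a x + b y ≤ d` is reflected across the line `a x + b y = d`. -/
noncomputable def halfFold (a b d : ℝ) (S : Set Plane) : Set Plane :=
  {p ∈ S | d ≤ a * p 0 + b * p 1} ∪ mirror a b d '' {p ∈ S | a * p 0 + b * p 1 ≤ d}

theorem affine_le_of_endpoints {α γ x l K : ℝ} (h0 : l ≤ x) (h1 : x ≤ 1)
    (hl : α * l + γ ≤ K) (hr : α * 1 + γ ≤ K) : α * x + γ ≤ K := by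
  rcases le_total 0 α with h | h
  · linarith [mul_le_mul_of_nonneg_left h1 h]
  · linarith [mul_le_mul_of_nonpos_left h0 h]

/-- An affine function on the trapezoid right of the line `x + m y = d` in the unit square is at
most its largest value at the vertices. -/
theorem affine_le_right {m d α β γ K x y : ℝ} (hx : x ≤ 1) (hy : 0 ≤ y) (hy1 : y ≤ 1)
    (hl : d ≤ x + m * y) (hA : α * d + γ ≤ K) (hB : α + γ ≤ K) (hC : α + β + γ ≤ K)
    (hD : α * (d - m) + β + γ ≤ K) : α * x + β * y + γ ≤ K := by
  have e : α * x + (β * y + γ) ≤ K := by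
    refine affine_le_of_endpoints (l := d - m * y) (by linarith) hx ?_ ?_
    · linarith [affine_le_of_endpoints (α := β - α * m) (γ := α * d + γ) (K := K) hy hy1
        (by linarith) (by linarith)]
    · linarith [affine_le_of_endpoints (α := β) (γ := α + γ) (K := K) hy hy1 (by linarith) (by linarith)]
  linarith

theorem affine_le_left {m d α β γ K x y : ℝ} (hx : 0 ≤ x) (hy : 0 ≤ y) (hy1 : y ≤ 1)
    (hl : x + m * y ≤ d) (hA : α * d + γ ≤ K) (hB : γ ≤ K) (hC : β + γ ≤ K)
    (hD : α * (d - m) + β + γ ≤ K) : α * x + β * y + γ ≤ K := by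
  have e : α * x + (β * y + γ) ≤ K := by
    rcases le_total 0 α with h | h
    · have h1 := mul_le_mul_of_nonneg_left (show x ≤ d - m * y by linarith) h
      linarith [affine_le_of_endpoints (α := β - α * m) (γ := α * d + γ) (K := K) hy hy1
        (by linarith) (by linarith)]
    · have h1 := mul_nonpos_of_nonpos_of_nonneg h hx
      linarith [affine_le_of_endpoints (α := β) (γ := γ) (K := K) hy hy1 (by linarith) (by linarith)]
  linarith

/-- A linear function on the folded unit square is at most its largest value at the six points
that can be vertices of the fold. Here `j = 1 / (1 + m²)`. -/
theorem linear_le_of_mem_halfFold {m d j α β K : ℝ} {p : Plane} (hj : j * (1 + m ^ 2) = 1)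
    (hp : p ∈ halfFold 1 m d unitSquare)
    (hA : α * d ≤ K) (hB : α ≤ K) (hC : α + β ≤ K) (hD : α * (d - m) + β ≤ K)
    (hP : α * (2 * d * j) + β * (2 * d * j * m) ≤ K)
    (hR : α * (2 * (d - m) * j) + β * (1 + 2 * (d - m) * j * m) ≤ K) :
    α * p 0 + β * p 1 ≤ K := by
  have hj' : j = 1 / (1 + m ^ 2) := eq_one_div_of_mul_eq_one_left hj
  rcases hp with ⟨hp, hl⟩ | ⟨x, ⟨hx, hl⟩, rfl⟩
  · obtain ⟨h1, h2, h3, h4⟩ := mem_unitSquare.1 hp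
    have := affine_le_right (α := α) (β := β) (γ := 0) h2 h3 h4 (by linarith) (by linarith)
      (by linarith) (by linarith) (by linarith) (d := d) (m := m) (K := K)
    linarith
  · obtain ⟨h1, h2, h3, h4⟩ := mem_unitSquare.1 hx
    -- The mirror is moved to the function: these are the coefficients of the linear function
    -- composed with the reflection.
    have := affine_le_left (α := α - 2 * j * (α + m * β)) (β := β - 2 * j * m * (α + m * β))
      (γ := 2 * j * d * (α + m * β)) h1 h3 h4 (by linarith) (by linarith)
      (by linarith) (by linarith) (by linarith) (d := d) (m := m) (K := K)
    have e : α * mirror 1 m d x 0 + β * mirror 1 m d x 1 = (α - 2 * j * (α + m * β)) * x 0 +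
        (β - 2 * j * m * (α + m * β)) * x 1 + 2 * j * d * (α + m * β) := by
      rw [mirror_zero, mirror_one, hj']
      ring
    rw [e]
    exact this

/-- Criterion for the folded unit square to be contained in a square with side direction
`(U, V)`. -/
theorem halfFold_subset_tiltedSquare {m d j U V r α β N : ℝ} (hj : j * (1 + m ^ 2) = 1)
    (hr : 0 < r)
    (hA : α ≤ U * d ∧ U * d ≤ α + N ∧ β ≤ -V * d ∧ -V * d ≤ β + N)
    (hB : α ≤ U ∧ U ≤ α + N ∧ β ≤ -V ∧ -V ≤ β + N)
    (hC : α ≤ U + V ∧ U + V ≤ α + N ∧ β ≤ -V + U ∧ -V + U ≤ β + N)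
    (hD : α ≤ U * (d - m) + V ∧ U * (d - m) + V ≤ α + N ∧
      β ≤ -V * (d - m) + U ∧ -V * (d - m) + U ≤ β + N)
    (hP : α ≤ 2 * d * j * (U + V * m) ∧ 2 * d * j * (U + V * m) ≤ α + N ∧
      β ≤ 2 * d * j * (-V + U * m) ∧ 2 * d * j * (-V + U * m) ≤ β + N)
    (hR : α ≤ V + 2 * (d - m) * j * (U + V * m) ∧ V + 2 * (d - m) * j * (U + V * m) ≤ α + N ∧
      β ≤ U + 2 * (d - m) * j * (-V + U * m) ∧ U + 2 * (d - m) * j * (-V + U * m) ≤ β + N) :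
    halfFold 1 m d unitSquare ⊆ tiltedSquare (U / r) (V / r) (α / r) (β / r) (N / r) := by
  intro p hp
  have h1 := linear_le_of_mem_halfFold (α := U) (β := V) (K := α + N) hj hp (by linarith)
    (by linarith) (by linarith) (by linarith) (by linarith) (by linarith)
  have h2 := linear_le_of_mem_halfFold (α := -U) (β := -V) (K := -α) hj hp (by linarith)
    (by linarith) (by linarith) (by linarith) (by linarith) (by linarith)
  have h3 := linear_le_of_mem_halfFold (α := -V) (β := U) (K := β + N) hj hp (by linarith)
    (by linarith) (by linarith) (by linarith) (by linarith) (by linarith)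
  have h4 := linear_le_of_mem_halfFold (α := V) (β := -U) (K := -β) hj hp (by linarith)
    (by linarith) (by linarith) (by linarith) (by linarith) (by linarith)
  refine ⟨?_, ?_, ?_, ?_⟩
  · rw [show U / r * p 0 + V / r * p 1 = (U * p 0 + V * p 1) / r by ring]
    exact div_le_div_of_nonneg_right (by linarith) hr.le
  · rw [show U / r * p 0 + V / r * p 1 = (U * p 0 + V * p 1) / r by ring, ← add_div]
    exact div_le_div_of_nonneg_right (by linarith) hr.le
  · rw [show -(V / r) * p 0 + U / r * p 1 = (-V * p 0 + U * p 1) / r by ring]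
    exact div_le_div_of_nonneg_right (by linarith) hr.le
  · rw [show -(V / r) * p 0 + U / r * p 1 = (-V * p 0 + U * p 1) / r by ring, ← add_div]
    exact div_le_div_of_nonneg_right (by linarith) hr.le

/-! ### The three covering squares -/

section covers

variable {m t j : ℝ}

/-- The axis-parallel covering square. -/
theorem halfFold_subset_axis (hm : 0 ≤ m) (ht : 0 ≤ t) (hmt : 2 * t + m ≤ 1)
    (hj : j * (1 + m ^ 2) = 1) :
    halfFold 1 m (t + m) unitSquare ⊆ tiltedSquare 1 0 t 0 (1 + 2 * t * j * m) := by
  have hj0 : 0 < j := by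
    by_contra! h
    have := mul_nonpos_of_nonpos_of_nonneg h (show 0 ≤ 1 + m ^ 2 by positivity)
    linarith
  -- Since j = 1/(1 + m²), the bounds at P and R reduce to polynomial inequalities in t and m.
  have hjk : ∀ {x y : ℝ}, x ≤ y * (1 + m ^ 2) → j * x ≤ y := fun {x y} h => by
    have := mul_le_mul_of_nonneg_left h hj0.le
    linear_combination this + y * hj
  have hjk' : ∀ {x y : ℝ}, y * (1 + m ^ 2) ≤ x → y ≤ j * x := fun {x y} h => by
    have := mul_le_mul_of_nonneg_left h hj0.le
    linear_combination this - y * hj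
  have htm : 0 ≤ t * m := mul_nonneg ht hm
  have htjm : 0 ≤ 2 * t * j * m := by positivity
  have hm1 : m ≤ 1 := by linarith
  have hmm : m * m ≤ m * 1 := mul_le_mul_of_nonneg_left hm1 hm
  have htmm : 0 ≤ (1 - m - 2 * t) * m := mul_nonneg (by linarith) hm
  have htmm2 : 0 ≤ (1 - m - 2 * t) * m * m := mul_nonneg htmm hm
  have p1 := hjk' (x := 2 * (t + m)) (y := t) (by
    have := mul_le_mul_of_nonneg_left (mul_le_one₀ hm1 hm hm1) ht
    linarith)
  have p2 := hjk (x := 2 * (t + m)) (y := t + 1) (by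
    have e1 := mul_nonneg (show 0 ≤ 1 - m by linarith) (show 0 ≤ 1 - m - 2 * t by linarith)
    have e2 := mul_nonneg (sq_nonneg (1 - m)) ht
    linarith)
  have p3 : 0 ≤ j * (2 * (t + m) * m) := by positivity
  have p4 := hjk (x := 2 * (t + m) * m) (y := 1) (by linarith)
  have r1 := hjk' (x := 2 * t) (y := t) (by
    have := mul_le_mul_of_nonneg_left (mul_le_one₀ hm1 hm hm1) ht
    linarith)
  have r2 := hjk (x := 2 * t) (y := t + 1) (by linarith [mul_nonneg htm hm, sq_nonneg m])
  have := halfFold_subset_tiltedSquare (m := m) (d := t + m) (U := 1) (V := 0) (r := 1) (α := t)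
    (β := 0) (N := 1 + 2 * t * j * m) hj one_pos
    ⟨by linarith, by linarith, by linarith, by linarith⟩
    ⟨by linarith, by linarith, by linarith, by linarith⟩
    ⟨by linarith, by linarith, by linarith, by linarith⟩
    ⟨by linarith, by linarith, by linarith, by linarith⟩
    ⟨by linarith, by linarith, by linarith, by linarith⟩
    ⟨by linarith, by linarith, by linarith, by linarith⟩
  simpa using this

/-- The covering square two of whose sides pass through the corner `(1, 0)` and the end points of
the fold line. -/
theorem halfFold_subset_diag (hm : 0 < m) (ht : 0 ≤ t) (hmt : 2 * t + m ≤ 1)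
    (hj : j * (1 + m ^ 2) = 1) {r : ℝ} (hr : 0 < r) :
    halfFold 1 m (t + m) unitSquare ⊆ tiltedSquare (t / r) ((t + m) / r) (t * (t + m) / r)
      (-(t + m) / r) ((t + (t + m) - t * (t + m)) / r) := by
  have hj0 : 0 < j := by
    by_contra! h
    have := mul_nonpos_of_nonpos_of_nonneg h (show 0 ≤ 1 + m ^ 2 by positivity)
    linarith
  have hjk : ∀ {x y : ℝ}, x ≤ y * (1 + m ^ 2) → j * x ≤ y := fun {x y} h => by
    have := mul_le_mul_of_nonneg_left h hj0.le
    linear_combination this + y * hj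
  have hjk' : ∀ {x y : ℝ}, y * (1 + m ^ 2) ≤ x → y ≤ j * x := fun {x y} h => by
    have := mul_le_mul_of_nonneg_left h hj0.le
    linear_combination this - y * hj
  obtain ⟨d, hd⟩ : ∃ d, d = t + m := ⟨_, rfl⟩
  rw [← hd]
  have htd : d - m = t := by linarith
  have hd0 : 0 < d := by linarith
  have hd1 : d ≤ 1 := by linarith
  have hm1 : m ≤ 1 := by linarith
  have hw : 0 ≤ 1 - m - 2 * t := by linarith
  have h1 : j * (2 * (t + d * m)) ≤ 1 := hjk (by
    rw [hd]; linarith [mul_nonneg hw hm.le])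
  have h2 : 0 ≤ j * (2 * (t + d * m)) := by positivity
  have h3 : t ≤ j * (2 * (t + d * m)) := hjk' (by
    have := mul_le_mul_of_nonneg_left (mul_le_one₀ hm1 hm.le hm1) ht
    have : 0 ≤ d * m := by positivity
    linarith)
  have hdm : 0 ≤ d - t * m := by
    have := mul_le_mul_of_nonneg_left hm1 ht
    linarith
  have h4 : 0 ≤ j * (2 * (d - t * m)) := mul_nonneg hj0.le (by linarith)
  have h5 : j * (2 * (d - t * m)) ≤ 1 := hjk (by
    rw [hd]; linarith [mul_nonneg hw (show 0 ≤ 1 - m by linarith)])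
  have h6 : d ≤ j * (2 * (d - t * m)) := hjk' (by
    rw [hd]
    have := mul_nonneg (mul_nonneg hm.le (show 0 ≤ 1 + m by linarith)) hw
    have := mul_nonneg ht (sq_nonneg m)
    linarith)
  have t1 := mul_le_mul_of_nonneg_left hd1 ht
  have t2 : 0 ≤ t * d := by positivity
  have t3 := mul_le_mul_of_nonneg_left hd1 hd0.le
  have t7 : 0 ≤ d * d := by positivity
  have t4 : t * t ≤ t * 1 := mul_le_mul_of_nonneg_left (by linarith) ht
  have t5 : t * t ≥ 0 := mul_nonneg ht ht
  have t6 : t * d ≤ 1 * d := mul_le_mul_of_nonneg_right (by linarith) hd0.le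
  refine halfFold_subset_tiltedSquare hj hr ?_ ?_ ?_ ?_ ?_ ?_
  · exact ⟨by linarith, by linarith, by linarith, by linarith⟩
  · exact ⟨by linarith, by linarith, by linarith, by linarith⟩
  · exact ⟨by linarith, by linarith, by linarith, by linarith⟩
  · rw [htd]
    exact ⟨by linarith, by linarith, by linarith, by linarith⟩
  · have e1 := mul_le_mul_of_nonneg_left h1 hd0.le
    have e2 := mul_le_mul_of_nonneg_left h3 hd0.le
    have e3 := mul_le_mul_of_nonneg_left h5 hd0.le
    have e4 := mul_nonneg hd0.le h4
    exact ⟨by linarith, by linarith, by linarith, by linarith⟩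
  · rw [htd]
    have e1 := mul_le_mul_of_nonneg_left h1 ht
    have e2 := mul_nonneg ht h2
    have e3 := mul_le_mul_of_nonneg_left h5 ht
    have e4 := mul_le_mul_of_nonneg_left h6 ht
    exact ⟨by linarith, by linarith, by linarith, by linarith⟩

/-- The covering square with a side through the corner `(1, 1)` and the mirror image of `(0, 1)`. -/
theorem halfFold_subset_flush (hm : 0 < m) (ht : 0 ≤ t) (hmt : 2 * t + m ≤ 1)
    (hj : j * (1 + m ^ 2) = 1) {a b r : ℝ} (ha : a = 2 * t * m) (hb : b = 1 + m ^ 2 - 2 * t)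
    (hr : 0 < r) :
    halfFold 1 m (t + m) unitSquare ⊆ tiltedSquare (a / r) (b / r) (a * (t + m) / r)
      (-b / r) ((a + b - a * (t + m)) / r) := by
  have hj0 : 0 < j := by
    by_contra! h
    have := mul_nonpos_of_nonpos_of_nonneg h (show 0 ≤ 1 + m ^ 2 by positivity)
    linarith
  have hjk : ∀ {x y : ℝ}, x ≤ y * (1 + m ^ 2) → j * x ≤ y := fun {x y} h => by
    have := mul_le_mul_of_nonneg_left h hj0.le
    linear_combination this + y * hj
  have hjk' : ∀ {x y : ℝ}, y * (1 + m ^ 2) ≤ x → y ≤ j * x := fun {x y} h => by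
    have := mul_le_mul_of_nonneg_left h hj0.le
    linear_combination this - y * hj
  obtain ⟨d, hd⟩ : ∃ d, d = t + m := ⟨_, rfl⟩
  rw [← hd]
  have htd : d - m = t := by linarith
  have hd0 : 0 < d := by linarith
  have hd1 : d ≤ 1 := by linarith
  have hm1 : m ≤ 1 := by linarith
  have hw : 0 ≤ 1 - m - 2 * t := by linarith
  have ha0 : 0 ≤ a := by rw [ha]; positivity
  have hb0 : 0 ≤ b := by rw [hb]; linarith [sq_nonneg m]
  have hbt : a * d ≤ b * t := by
    rw [ha, hb, hd]
    linarith [mul_nonneg (mul_nonneg ht (show 0 ≤ 1 + m by linarith)) hw]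
  have hbt1 : b * t ≤ b * 1 := mul_le_mul_of_nonneg_left (by linarith) hb0
  have had : a * d ≤ a * 1 := mul_le_mul_of_nonneg_left hd1 ha0
  have had0 : 0 ≤ a * d := mul_nonneg ha0 hd0.le
  have hbd : b * d ≤ b * 1 := mul_le_mul_of_nonneg_left hd1 hb0
  have hbd0 : 0 ≤ b * d := mul_nonneg hb0 hd0.le
  have hat : a * t ≤ a * 1 := mul_le_mul_of_nonneg_left (by linarith) ha0
  have hat0 : 0 ≤ a * t := mul_nonneg ha0 ht
  have hbm : j * (a + b * m) = m := by
    rw [ha, hb]; linear_combination m * hj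
  have hbam : b - a * m ≥ 0 := by
    rw [ha, hb]
    have := mul_nonneg ht (mul_nonneg (show 0 ≤ 1 - m by linarith) (show 0 ≤ 1 + m by linarith))
    linarith [mul_nonneg hw (show 0 ≤ m + 1 by linarith), mul_nonneg hw (sq_nonneg m),
      mul_nonneg hm.le (mul_nonneg hm.le hm.le)]
  -- In the second side direction P exceeds the level of B by a perfect square, so B stays extreme.
  have hP : 2 * d * j * (b - a * m) = b - (1 - m - 2 * t) ^ 2 := by
    rw [ha, hb, hd]
    linear_combination (1 + m ^ 2 - 2 * t - (1 - m - 2 * t) ^ 2) * hj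
  refine halfFold_subset_tiltedSquare hj hr ?_ ?_ ?_ ?_ ?_ ?_
  · exact ⟨by linarith, by linarith, by linarith, by linarith⟩
  · exact ⟨by linarith, by linarith, by linarith, by linarith⟩
  · exact ⟨by linarith, by linarith, by linarith, by linarith⟩
  · rw [htd]
    exact ⟨by linarith, by linarith, by linarith, by linarith⟩
  · have e1 : 2 * d * j * (a + b * m) = 2 * d * m := by linear_combination 2 * d * hbm
    have e2 : 0 ≤ 2 * d * j * (b - a * m) := by positivity
    have e3 : 2 * d * m ≤ a + b := by
      rw [ha, hb, hd]
      linarith [mul_nonneg hw (show 0 ≤ 1 + m by linarith), mul_nonneg hm.le ht]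
    have e4 : a * d ≤ 2 * d * m := by
      rw [ha]
      have : t * (m * d) ≤ 1 * (m * d) :=
        mul_le_mul_of_nonneg_right (by linarith) (by positivity)
      linarith
    exact ⟨by linarith, by linarith, by linarith [sq_nonneg (1 - m - 2 * t)], by linarith⟩
  · rw [htd]
    have e1 : 2 * t * j * (a + b * m) = a := by
      rw [ha] at hbm ⊢; linear_combination 2 * t * hbm
    have e2 : 2 * t * (m * d) ≤ 2 * t * (j * (b - a * m)) := by
      refine mul_le_mul_of_nonneg_left (hjk' ?_) (by linarith)
      rw [ha, hb, hd]
      have := mul_nonneg (show 0 ≤ 1 + m ^ 2 by positivity)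
        (show 0 ≤ (1 - m - 2 * t) * (1 + m / 2) + m / 2 * (1 - m) by
          have := mul_nonneg hw (show 0 ≤ 1 + m / 2 by linarith)
          have := mul_nonneg hm.le (show 0 ≤ 1 - m by linarith)
          linarith)
      linarith
    have e3 : 2 * t * (j * (b - a * m)) ≤ 1 * b := by
      refine mul_le_mul (by linarith) (hjk ?_) (mul_nonneg hj0.le hbam) zero_le_one
      have := mul_nonneg hb0 (sq_nonneg m)
      have := mul_nonneg ha0 hm.le
      linarith
    have e4 : a * d = 2 * t * (m * d) := by rw [ha]; ring
    exact ⟨by linarith, by linarith, by linarith, by linarith⟩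

end covers

/-! ### Congruence and normal form of folds -/

/-- `F` is the image of `G` under an isometry of the plane. -/
def IsCongruentTo (F G : Set Plane) : Prop := ∃ g : Plane ≃ᵢ Plane, F = g '' G

namespace IsCongruentTo

variable {F G H : Set Plane}

theorem symm : IsCongruentTo F G → IsCongruentTo G F := by
  rintro ⟨g, rfl⟩
  refine ⟨g.symm, ?_⟩
  rw [Set.image_image]
  simp

theorem refl (F : Set Plane) : IsCongruentTo F F :=
  ⟨IsometryEquiv.refl _, (Set.image_id F).symm⟩

theorem trans : IsCongruentTo F G → IsCongruentTo G H → IsCongruentTo F H := by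
  rintro ⟨g, rfl⟩ ⟨g', rfl⟩
  exact ⟨g'.trans g, by rw [Set.image_image]; rfl⟩

theorem coveredBy {c : ℝ} {S : Set Plane} :
    IsCongruentTo F G → CoveredBy c S G → CoveredBy c S F := by
  rintro ⟨g, rfl⟩ ⟨_, ⟨g', rfl⟩, h⟩
  refine ⟨g '' (g' '' (c • S)), ⟨g'.trans g, ?_⟩, Set.image_mono h⟩
  rw [Set.image_image]; rfl

end IsCongruentTo

/-- The normal (a, b) is transformed by the orthogonal part alone, so the level d is scaled by κ and
shifted by the product of the new normal with the translation. -/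
theorem simMap_image_halfFold {κ c s ε : ℝ} (b₀ b₁ a b d : ℝ) (hκ : 0 < κ)
    (h : c ^ 2 + s ^ 2 = 1) (hε : ε ^ 2 = 1) (S : Set Plane) :
    halfFold (c * a - ε * s * b) (s * a + ε * c * b)
      (κ * d + ((c * a - ε * s * b) * b₀ + (s * a + ε * c * b) * b₁))
      (simMap κ c s ε b₀ b₁ '' S) = simMap κ c s ε b₀ b₁ '' halfFold a b d S := by
  have key : ∀ x : Plane, (c * a - ε * s * b) * simMap κ c s ε b₀ b₁ x 0 +
      (s * a + ε * c * b) * simMap κ c s ε b₀ b₁ x 1 = κ * (a * x 0 + b * x 1) +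
      ((c * a - ε * s * b) * b₀ + (s * a + ε * c * b) * b₁) := by
    intro x
    simp only [simMap_zero, simMap_one]
    linear_combination (κ * (a * x 0 + ε ^ 2 * b * x 1)) * h + κ * b * x 1 * hε
  have hn : (c * a - ε * s * b) ^ 2 + (s * a + ε * c * b) ^ 2 = a ^ 2 + b ^ 2 := by
    linear_combination (a ^ 2 + ε ^ 2 * b ^ 2) * h + b ^ 2 * hε
  have hmir : ∀ x : Plane, mirror (c * a - ε * s * b) (s * a + ε * c * b)
      (κ * d + ((c * a - ε * s * b) * b₀ + (s * a + ε * c * b) * b₁))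
      (simMap κ c s ε b₀ b₁ x) = simMap κ c s ε b₀ b₁ (mirror a b d x) := by
    intro x
    apply plane_ext
    · rw [mirror_zero, key, hn, simMap_zero, simMap_zero, mirror_zero, mirror_one]
      ring
    · rw [mirror_one, key, hn, simMap_one, simMap_one, mirror_zero, mirror_one]
      ring
  unfold halfFold
  rw [Set.image_union]
  congr 1
  · ext p
    constructor
    · rintro ⟨⟨x, hx, rfl⟩, hl⟩
      rw [key] at hl
      exact ⟨x, ⟨hx, le_of_mul_le_mul_left (by linarith) hκ⟩, rfl⟩
    · rintro ⟨x, ⟨hx, hl⟩, rfl⟩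
      refine ⟨⟨x, hx, rfl⟩, ?_⟩
      rw [key]
      linarith [mul_le_mul_of_nonneg_left hl hκ.le]
  · ext p
    constructor
    · rintro ⟨_, ⟨⟨x, hx, rfl⟩, hl⟩, rfl⟩
      rw [key] at hl
      exact ⟨_, ⟨x, ⟨hx, le_of_mul_le_mul_left (by linarith) hκ⟩, rfl⟩, (hmir x).symm⟩
    · rintro ⟨_, ⟨x, ⟨hx, hl⟩, rfl⟩, rfl⟩
      refine ⟨_, ⟨⟨x, hx, rfl⟩, ?_⟩, hmir x⟩
      rw [key]
      linarith [mul_le_mul_of_nonneg_left hl hκ.le]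

theorem exists_isometryEquiv_eq_mirror {a b : ℝ} (d : ℝ) (h : 0 < a ^ 2 + b ^ 2) :
    ∃ g : Plane ≃ᵢ Plane, ∀ x, g x = mirror a b d x := by
  obtain ⟨g, hg⟩ := exists_isometryEquiv_eq_simMap (c := (b ^ 2 - a ^ 2) / (a ^ 2 + b ^ 2))
    (s := -(2 * a * b) / (a ^ 2 + b ^ 2)) (ε := -1) (2 * d * a / (a ^ 2 + b ^ 2))
    (2 * d * b / (a ^ 2 + b ^ 2)) (by field_simp; ring) (by norm_num)
  refine ⟨g, fun x => ?_⟩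
  rw [hg]
  apply plane_ext
  · rw [simMap_zero, mirror_zero]; field_simp; ring
  · rw [simMap_one, mirror_one]; field_simp; ring

theorem mirror_neg (a b d : ℝ) : mirror (-a) (-b) (-d) = mirror a b d := by
  funext x
  apply plane_ext <;> simp <;> ring

theorem mirror_mirror {a b : ℝ} (d : ℝ) (h : 0 < a ^ 2 + b ^ 2) (x : Plane) :
    mirror a b d (mirror a b d x) = x := by
  apply plane_ext
  · rw [mirror_zero, mirror_zero, mirror_one]; field_simp; ring
  · rw [mirror_one, mirror_zero, mirror_one]; field_simp; ring

/-- Reflecting one side or the other gives two shapes that are mirror images in the fold line. -/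
theorem halfFold_neg_congruent {a b : ℝ} (d : ℝ) (h : 0 < a ^ 2 + b ^ 2) (S : Set Plane) :
    IsCongruentTo (halfFold (-a) (-b) (-d) S) (halfFold a b d S) := by
  obtain ⟨g, hg⟩ := exists_isometryEquiv_eq_mirror d h
  refine ⟨g, ?_⟩
  have hgm : (g : Plane → Plane) = mirror a b d := funext hg
  unfold halfFold
  rw [hgm, mirror_neg, Set.image_union, Set.image_image, Set.union_comm]
  simp only [mirror_mirror d h, Set.image_id']
  congr 1
  · congr 1; ext p; simp only [Set.mem_ofPred_eq]
    exact and_congr_right fun _ => ⟨fun h => by linarith, fun h => by linarith⟩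
  · ext p; simp only [Set.mem_ofPred_eq]
    exact and_congr_right fun _ => ⟨fun h => by linarith, fun h => by linarith⟩

theorem halfFold_smul {l : ℝ} (hl : 0 < l) (a b d : ℝ) (S : Set Plane) :
    halfFold (l * a) (l * b) (l * d) S = halfFold a b d S := by
  have hm : mirror (l * a) (l * b) (l * d) = mirror a b d := by
    funext x
    have e : ∀ u v w : ℝ, 2 * (l * a * u + l * b * v - l * d) / ((l * a) ^ 2 + (l * b) ^ 2) *
        (l * w) = 2 * (a * u + b * v - d) / (a ^ 2 + b ^ 2) * w := by
      intro u v w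
      rw [show (l * a) ^ 2 + (l * b) ^ 2 = l ^ 2 * (a ^ 2 + b ^ 2) by ring,
        show 2 * (l * a * u + l * b * v - l * d) = l * (2 * (a * u + b * v - d)) by ring]
      generalize a ^ 2 + b ^ 2 = k
      field_simp
    apply plane_ext
    · rw [mirror_zero, mirror_zero, e]
    · rw [mirror_one, mirror_one, e]
  have e : ∀ p : Plane, l * a * p 0 + l * b * p 1 = l * (a * p 0 + b * p 1) := fun p => by ring
  unfold halfFold
  simp only [hm, e, mul_le_mul_iff_right₀ hl]

theorem halfFold_congruent_of_symmetry {c s ε b₀ b₁ : ℝ} (a b d : ℝ) (h : c ^ 2 + s ^ 2 = 1)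
    (hε : ε ^ 2 = 1) (hS : simMap 1 c s ε b₀ b₁ '' unitSquare = unitSquare) :
    IsCongruentTo (halfFold (c * a - ε * s * b) (s * a + ε * c * b)
      (d + ((c * a - ε * s * b) * b₀ + (s * a + ε * c * b) * b₁)) unitSquare)
      (halfFold a b d unitSquare) := by
  obtain ⟨g, hg⟩ := exists_isometryEquiv_eq_simMap b₀ b₁ h hε
  refine ⟨g, ?_⟩
  have hgm : (g : Plane → Plane) = simMap 1 c s ε b₀ b₁ := funext hg
  have := simMap_image_halfFold b₀ b₁ a b d one_pos h hε unitSquare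
  rw [hS, one_mul] at this
  rw [this, hgm]

theorem halfFold_swap_congruent (a b d : ℝ) :
    IsCongruentTo (halfFold b a d unitSquare) (halfFold a b d unitSquare) := by
  have := halfFold_congruent_of_symmetry (c := 0) (s := 1) (ε := -1) (b₀ := 0) (b₁ := 0) a b d
    (by norm_num) (by norm_num) (by
      rw [simMap_neg_image_unitSquare, simMap_image_unitSquare_pos _ _ one_pos (by norm_num)]
      ext p
      rw [mem_unitSquare]
      simp only [tiltedSquare, Set.mem_ofPred_eq]
      constructor
      · rintro ⟨h1, h2, h3, h4⟩
        exact ⟨by linarith, by linarith, by linarith, by linarith⟩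
      · rintro ⟨h1, h2, h3, h4⟩
        exact ⟨by linarith, by linarith, by linarith, by linarith⟩)
  simpa using this

theorem halfFold_flip_fst_congruent (a b d : ℝ) :
    IsCongruentTo (halfFold (-a) b (d - a) unitSquare) (halfFold a b d unitSquare) := by
  have := halfFold_congruent_of_symmetry (c := -1) (s := 0) (ε := -1) (b₀ := 1) (b₁ := 0) a b d
    (by norm_num) (by norm_num) (by
      rw [simMap_neg_image_unitSquare, simMap_image_unitSquare_pos _ _ one_pos (by norm_num)]
      ext p
      rw [mem_unitSquare]
      simp only [tiltedSquare, Set.mem_ofPred_eq]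
      constructor
      · rintro ⟨h1, h2, h3, h4⟩
        exact ⟨by linarith, by linarith, by linarith, by linarith⟩
      · rintro ⟨h1, h2, h3, h4⟩
        exact ⟨by linarith, by linarith, by linarith, by linarith⟩)
  simpa [sub_eq_add_neg] using this

theorem halfFold_flip_snd_congruent (a b d : ℝ) :
    IsCongruentTo (halfFold a (-b) (d - b) unitSquare) (halfFold a b d unitSquare) :=
  (halfFold_swap_congruent _ _ _).trans
    ((halfFold_flip_fst_congruent _ _ _).trans (halfFold_swap_congruent _ _ _))

/-- Every fold of the unit square is congruent to one with a line `x + m y = d` where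
`0 ≤ m ≤ 1`, such that the reflected part is not the larger one. -/
theorem halfFold_congruent_normal {a b : ℝ} (d : ℝ) (h : 0 < a ^ 2 + b ^ 2) :
    ∃ m d' : ℝ, 0 ≤ m ∧ m ≤ 1 ∧ 2 * d' ≤ 1 + m ∧
      IsCongruentTo (halfFold a b d unitSquare) (halfFold 1 m d' unitSquare) := by
  have h1 : ∃ a' b' d' : ℝ, |b'| ≤ |a'| ∧ a' ≠ 0 ∧
      IsCongruentTo (halfFold a b d unitSquare) (halfFold a' b' d' unitSquare) := by
    rcases le_total |b| |a| with hab | hab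
    · refine ⟨a, b, d, hab, ?_, .refl _⟩
      rintro rfl
      have : b = 0 := by simpa using hab
      simp [this] at h
    · refine ⟨b, a, d, hab, ?_, halfFold_swap_congruent _ _ _⟩
      rintro rfl
      have : a = 0 := by simpa using hab
      simp [this] at h
  obtain ⟨a₁, b₁, d₁, hab, ha, c1⟩ := h1
  have h2 : ∃ d', IsCongruentTo (halfFold a₁ b₁ d₁ unitSquare)
      (halfFold |a₁| b₁ d' unitSquare) := by
    rcases abs_cases a₁ with ⟨e, -⟩ | ⟨e, -⟩
    · exact ⟨d₁, by rw [e]; exact .refl _⟩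
    · exact ⟨d₁ - a₁, by rw [e]; exact (halfFold_flip_fst_congruent _ _ _).symm⟩
  obtain ⟨d₂, c2⟩ := h2
  have h3 : ∃ d', IsCongruentTo (halfFold |a₁| b₁ d₂ unitSquare)
      (halfFold |a₁| |b₁| d' unitSquare) := by
    rcases abs_cases b₁ with ⟨e, -⟩ | ⟨e, -⟩
    · exact ⟨d₂, by rw [e]; exact .refl _⟩
    · exact ⟨d₂ - b₁, by rw [e]; exact (halfFold_flip_snd_congruent _ _ _).symm⟩
  obtain ⟨d₃, c3⟩ := h3
  have ha' : 0 < |a₁| := abs_pos.2 ha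
  obtain ⟨m, hm⟩ : ∃ m, m = |b₁| / |a₁| := ⟨_, rfl⟩
  have hm0 : 0 ≤ m := hm ▸ by positivity
  have hm1 : m ≤ 1 := hm ▸ (div_le_one ha').2 hab
  have c4 : halfFold |a₁| |b₁| d₃ unitSquare = halfFold 1 m (d₃ / |a₁|) unitSquare := by
    rw [← halfFold_smul ha' 1, hm, mul_one, mul_div_cancel₀ _ ha'.ne', mul_div_cancel₀ _ ha'.ne']
  have c5 := c1.trans (c2.trans c3)
  rw [c4] at c5
  obtain ⟨d₄, hd₄⟩ : ∃ d₄, d₄ = d₃ / |a₁| := ⟨_, rfl⟩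
  rw [← hd₄] at c5
  rcases le_total (2 * d₄) (1 + m) with hd | hd
  · exact ⟨m, d₄, hm0, hm1, hd, c5⟩
  · refine ⟨m, 1 + m - d₄, hm0, hm1, by linarith, c5.trans ?_⟩
    -- Reflecting the other side and turning the square by half a turn replaces d by 1 + m - d.
    have e := (halfFold_neg_congruent (a := -1) (b := -m) (d₄ - 1 - m) (by positivity)
      unitSquare)
    have e2 := halfFold_flip_snd_congruent (-1) m (d₄ - 1)
    have e3 := halfFold_flip_fst_congruent 1 m d₄
    have := (e.trans (e2.trans e3)).symm
    convert this using 2 <;> ring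

/-! ### Single folds as half-folds -/

theorem mem_line_iff {p q : Plane} (h : p ≠ q) (x : Plane) : x ∈ line[ℝ, p, q] ↔
    (p 1 - q 1) * x 0 + (q 0 - p 0) * x 1 = (p 1 - q 1) * p 0 + (q 0 - p 0) * p 1 := by
  constructor
  · intro hx
    rw [← vsub_vadd x p, vadd_left_mem_affineSpan_pair] at hx
    obtain ⟨r, hr⟩ := hx
    have e0 := congrArg (fun v : Plane => v 0) hr
    have e1 := congrArg (fun v : Plane => v 1) hr
    simp at e0 e1
    linear_combination -(p 1 - q 1) * e0 - (q 0 - p 0) * e1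
  · intro hx
    have hpos : 0 < (p 1 - q 1) ^ 2 + (q 0 - p 0) ^ 2 := by
      by_contra! h0
      have h1 := sq_nonneg (p 1 - q 1)
      have h2 := sq_nonneg (q 0 - p 0)
      refine h (plane_ext ?_ ?_)
      · have := pow_eq_zero_iff (two_ne_zero) |>.1 (show (q 0 - p 0) ^ 2 = 0 by linarith)
        linarith
      · have := pow_eq_zero_iff (two_ne_zero) |>.1 (show (p 1 - q 1) ^ 2 = 0 by linarith)
        linarith
    rw [← vsub_vadd x p, vadd_left_mem_affineSpan_pair]
    refine ⟨((q 0 - p 0) * (x 0 - p 0) - (p 1 - q 1) * (x 1 - p 1)) /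
        ((p 1 - q 1) ^ 2 + (q 0 - p 0) ^ 2), plane_ext ?_ ?_⟩
    · simp
      field_simp
      linear_combination -(p 1 - q 1) * hx
    · simp
      field_simp
      linear_combination -(q 0 - p 0) * hx

theorem reflection_line_eq_mirror {p q : Plane} {a b d : ℝ} (h0 : 0 < a ^ 2 + b ^ 2)
    (h : ∀ x, x ∈ line[ℝ, p, q] ↔ a * x 0 + b * x 1 = d) (x : Plane) :
    EuclideanGeometry.reflection line[ℝ, p, q] x = mirror a b d x := by
  have hp := (h p).1 (left_mem_affineSpan_pair ℝ p q)
  have hq := (h q).1 (right_mem_affineSpan_pair ℝ p q)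
  have e : (EuclideanGeometry.orthogonalProjection line[ℝ, p, q] x : Plane) =
      !₂[x 0 - (a * x 0 + b * x 1 - d) / (a ^ 2 + b ^ 2) * a,
        x 1 - (a * x 0 + b * x 1 - d) / (a ^ 2 + b ^ 2) * b] := by
    rw [EuclideanGeometry.coe_orthogonalProjection_eq_iff_mem]
    constructor
    · rw [h]
      simp
      field_simp
      ring
    · rw [direction_affineSpan, Submodule.mem_orthogonal]
      intro u hu
      obtain ⟨r, rfl⟩ := mem_vectorSpan_pair.1 hu
      simp [PiLp.inner_apply, Fin.sum_univ_two]
      linear_combination ((a * x 0 + b * x 1 - d) / (a ^ 2 + b ^ 2)) * r * (hp - hq)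
  rw [EuclideanGeometry.reflection_apply', e]
  apply plane_ext
  · simp; ring
  · simp; ring

theorem isPreconnected_inter_halfPlane {S : Set Plane} (hS : Convex ℝ S) (a b d : ℝ) :
    IsPreconnected {p ∈ S | a * p 0 + b * p 1 < d} := by
  apply Convex.isPreconnected
  intro x hx y hy u v hu hv huv
  refine ⟨hS hx.1 hy.1 hu hv huv, ?_⟩
  have e : a * (u • x + v • y) 0 + b * (u • x + v • y) 1 =
    u * (a * x 0 + b * x 1) + v * (a * y 0 + b * y 1) := by simp; ring
  rw [e]
  have h1 := hx.2
  have h2 := hy.2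
  rcases hu.eq_or_lt with rfl | hu'
  · have : v = 1 := by linarith
    rw [this]; linarith
  · have := mul_lt_mul_of_pos_left h1 hu'
    have := mul_le_mul_of_nonneg_left h2.le hv
    have : u * d + v * d = d := by rw [← add_mul, huv, one_mul]
    linarith

/-- The component cannot meet both open half-planes, and the part of a convex set in one of them is
convex, hence connected. -/
theorem connectedComponentIn_sdiff_line {S : Set Plane} (hS : Convex ℝ S) {a b d : ℝ} {x : Plane}
    (hx : x ∈ S) (hxd : a * x 0 + b * x 1 < d) :
    connectedComponentIn (S \ {p | a * p 0 + b * p 1 = d}) x =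
      {p ∈ S | a * p 0 + b * p 1 < d} := by
  have hc : Continuous fun p : Plane => a * p 0 + b * p 1 := by fun_prop
  apply Set.Subset.antisymm
  · have hsub := connectedComponentIn_subset (S \ {p : Plane | a * p 0 + b * p 1 = d}) x
    have hxm : x ∈ S \ {p : Plane | a * p 0 + b * p 1 = d} := ⟨hx, hxd.ne⟩
    have := IsPreconnected.subset_left_of_subset_union
      (s := connectedComponentIn (S \ {p : Plane | a * p 0 + b * p 1 = d}) x)
      (isOpen_lt hc continuous_const : IsOpen {p : Plane | a * p 0 + b * p 1 < d})
      (isOpen_lt continuous_const hc : IsOpen {p : Plane | d < a * p 0 + b * p 1})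
      (Set.disjoint_left.2 fun p h1 h2 => by
        rw [Set.mem_ofPred_eq] at h1 h2; exact lt_asymm h1 h2)
      (fun p hp => lt_or_gt_of_ne (hsub hp).2)
      ⟨x, mem_connectedComponentIn hxm, hxd⟩ isPreconnected_connectedComponentIn
    exact fun p hp => ⟨(hsub hp).1, this hp⟩
  · refine IsPreconnected.subset_connectedComponentIn (isPreconnected_inter_halfPlane hS a b d)
      ⟨hx, hxd⟩ fun p hp => ⟨hp.1, ?_⟩
    exact ne_of_lt hp.2

theorem mirror_of_mem {a b d : ℝ} {p : Plane} (h : a * p 0 + b * p 1 = d) :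
    mirror a b d p = p := by
  apply plane_ext <;> simp [h]

/-- Points of the fold line are fixed by the reflection, so open and closed sides give the same set.
-/
theorem halfFold_eq {S : Set Plane} (a b d : ℝ) :
    halfFold a b d S = (S \ {p ∈ S | a * p 0 + b * p 1 < d}) ∪
      mirror a b d '' {p ∈ S | a * p 0 + b * p 1 < d} := by
  ext x
  constructor
  · rintro (⟨hx, hl⟩ | ⟨y, ⟨hy, hl⟩, rfl⟩)
    · exact Or.inl ⟨hx, fun h => absurd h.2 (not_lt.2 hl)⟩
    · rcases hl.eq_or_lt with h | h
      · rw [mirror_of_mem h]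
        exact Or.inl ⟨hy, fun h' => h'.2.ne h⟩
      · exact Or.inr ⟨y, ⟨hy, h⟩, rfl⟩
  · rintro (⟨hx, hl⟩ | ⟨y, ⟨hy, hl⟩, rfl⟩)
    · exact Or.inl ⟨hx, not_lt.1 fun h => hl ⟨hx, h⟩⟩
    · exact Or.inr ⟨y, ⟨hy, hl.le⟩, rfl⟩

theorem halfFold_mem_singleFolds {S : Set Plane} (hS : Convex ℝ S) {a b d : ℝ}
    (h : 0 < a ^ 2 + b ^ 2) {x : Plane} (hx : x ∈ S) (hxd : a * x 0 + b * x 1 < d) :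
    halfFold a b d S ∈ singleFolds S := by
  obtain ⟨p, hp⟩ : ∃ p : Plane, p = !₂[d * a / (a ^ 2 + b ^ 2), d * b / (a ^ 2 + b ^ 2)] :=
    ⟨_, rfl⟩
  obtain ⟨q, hq⟩ : ∃ q : Plane, q = !₂[p 0 + b, p 1 - a] := ⟨_, rfl⟩
  have hp0 : a * p 0 + b * p 1 = d := by
    rw [hp]; simp; field_simp
  have hq0 : q 0 = p 0 + b := by rw [hq]; rfl
  have hq1 : q 1 = p 1 - a := by rw [hq]; rfl
  have hpq : p ≠ q := by
    intro e
    rw [← e] at hq0 hq1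
    have ha : a = 0 := by linarith
    have hb : b = 0 := by linarith
    rw [ha, hb] at h
    norm_num at h
  have hline : ∀ x, x ∈ line[ℝ, p, q] ↔ a * x 0 + b * x 1 = d := by
    intro x
    rw [mem_line_iff hpq, hq0, hq1, ← hp0]
    ring_nf
  have hset : (line[ℝ, p, q] : Set Plane) = {x | a * x 0 + b * x 1 = d} := Set.ext hline
  refine ⟨p, q, hpq, {{y ∈ S | a * y 0 + b * y 1 < d}}, Set.singleton_nonempty _, ?_, ?_⟩
  · rintro _ rfl
    refine ⟨x, ⟨hx, ?_⟩, ?_⟩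
    · rw [hset]; exact hxd.ne
    · rw [hset, connectedComponentIn_sdiff_line hS hx hxd]
  · rw [Set.sUnion_singleton, halfFold_eq]
    congr 1
    exact Set.image_congr fun y _ => (reflection_line_eq_mirror h hline y).symm

/-- Only the two sides L and U can be components. Reflecting both moves the whole of S; reflecting
one gives a half-fold, with negated coefficients for U. -/
theorem singleFolds_cases {S F : Set Plane} (hS : Convex ℝ S) (hF : F ∈ singleFolds S) :
    ∃ a b d : ℝ, 0 < a ^ 2 + b ^ 2 ∧ (F = halfFold a b d S ∨ F = mirror a b d '' S) := by
  obtain ⟨p, q, hpq, 𝒞, ⟨C₀, hC₀⟩, hsub, rfl⟩ := hF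
  obtain ⟨a, ha⟩ : ∃ a, a = p 1 - q 1 := ⟨_, rfl⟩
  obtain ⟨b, hb⟩ : ∃ b, b = q 0 - p 0 := ⟨_, rfl⟩
  obtain ⟨d, hd⟩ : ∃ d, d = a * p 0 + b * p 1 := ⟨_, rfl⟩
  have hline : ∀ x, x ∈ line[ℝ, p, q] ↔ a * x 0 + b * x 1 = d := by
    intro x
    rw [mem_line_iff hpq, hd, ha, hb]
  have h : 0 < a ^ 2 + b ^ 2 := by
    by_contra! h0
    have h1 := sq_nonneg a
    have h2 := sq_nonneg b
    refine hpq (plane_ext ?_ ?_)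
    · have := pow_eq_zero_iff (two_ne_zero) |>.1 (show b ^ 2 = 0 by linarith)
      linarith
    · have := pow_eq_zero_iff (two_ne_zero) |>.1 (show a ^ 2 = 0 by linarith)
      linarith
  have hset : (line[ℝ, p, q] : Set Plane) = {x | a * x 0 + b * x 1 = d} := Set.ext hline
  have hrefl : (EuclideanGeometry.reflection line[ℝ, p, q] : Plane → Plane) = mirror a b d :=
    funext (reflection_line_eq_mirror h hline)
  rw [hrefl]
  rw [hset] at hsub
  obtain ⟨L, hL⟩ : ∃ L : Set Plane, L = {y ∈ S | a * y 0 + b * y 1 < d} := ⟨_, rfl⟩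
  obtain ⟨U, hU⟩ : ∃ U : Set Plane, U = {y ∈ S | -a * y 0 + -b * y 1 < -d} := ⟨_, rfl⟩
  have hcomp : ∀ C ∈ 𝒞, C = L ∨ C = U := by
    intro C hC
    obtain ⟨x, hx, rfl⟩ := hsub hC
    rcases lt_or_gt_of_ne hx.2 with hlt | hgt
    · left; rw [hL, connectedComponentIn_sdiff_line hS hx.1 hlt]
    · right
      rw [hU, ← connectedComponentIn_sdiff_line hS hx.1 (by linarith)]
      congr 2
      ext y
      exact ⟨fun (h : _ = _) => show _ = _ by linarith, fun (h : _ = _) => show _ = _ by linarith⟩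
  have hhL : (S \ L) ∪ mirror a b d '' L = halfFold a b d S := by rw [halfFold_eq, hL]
  have hhU : (S \ U) ∪ mirror a b d '' U = halfFold (-a) (-b) (-d) S := by
    rw [halfFold_eq, hU, mirror_neg]
  by_cases hLm : L ∈ 𝒞
  · by_cases hUm : U ∈ 𝒞
    · refine ⟨a, b, d, h, Or.inr ?_⟩
      have hun : ⋃₀ 𝒞 = L ∪ U := by
        apply Set.Subset.antisymm
        · refine Set.sUnion_subset fun C hC => ?_
          rcases hcomp C hC with rfl | rfl
          · exact Set.subset_union_left
          · exact Set.subset_union_right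
        · exact Set.union_subset (Set.subset_sUnion_of_mem hLm) (Set.subset_sUnion_of_mem hUm)
      rw [hun]
      ext y
      constructor
      · rintro (⟨hy, hn⟩ | ⟨z, hz, rfl⟩)
        · refine ⟨y, hy, mirror_of_mem ?_⟩
          rcases lt_trichotomy (a * y 0 + b * y 1) d with hlt | heq | hgt
          · exact absurd (Or.inl (hL ▸ ⟨hy, hlt⟩)) hn
          · exact heq
          · exact absurd (Or.inr (hU ▸ ⟨hy, show _ < _ by linarith⟩)) hn
        · refine ⟨z, ?_, rfl⟩
          rcases hz with hz | hz
          · rw [hL] at hz; exact hz.1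
          · rw [hU] at hz; exact hz.1
      · rintro ⟨z, hz, rfl⟩
        rcases lt_trichotomy (a * z 0 + b * z 1) d with hlt | heq | hgt
        · exact Or.inr ⟨z, Or.inl (hL ▸ ⟨hz, hlt⟩), rfl⟩
        · rw [mirror_of_mem heq]
          refine Or.inl ⟨hz, ?_⟩
          rintro (h' | h')
          · rw [hL] at h'; exact h'.2.ne heq
          · rw [hU] at h'
            have : -a * z 0 + -b * z 1 < -d := h'.2
            linarith
        · exact Or.inr ⟨z, Or.inr (hU ▸ ⟨hz, show _ < _ by linarith⟩), rfl⟩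
    · refine ⟨a, b, d, h, Or.inl ?_⟩
      have hun : ⋃₀ 𝒞 = L := by
        apply Set.Subset.antisymm
        · refine Set.sUnion_subset fun C hC => ?_
          rcases hcomp C hC with rfl | rfl
          · exact subset_rfl
          · exact absurd hC hUm
        · exact Set.subset_sUnion_of_mem hLm
      rw [hun, hhL]
  · refine ⟨-a, -b, -d, by linarith, Or.inl ?_⟩
    have hUm : U ∈ 𝒞 := by
      rcases hcomp C₀ hC₀ with rfl | rfl
      · exact absurd hC₀ hLm
      · exact hC₀
    have hun : ⋃₀ 𝒞 = U := by
      apply Set.Subset.antisymm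
      · refine Set.sUnion_subset fun C hC => ?_
        rcases hcomp C hC with rfl | rfl
        · exact absurd hC hLm
        · exact subset_rfl
      · exact Set.subset_sUnion_of_mem hUm
    rw [hun, hhU]

/-! ### Upper bound: folds other than the extremal one -/

theorem coveredBy_unitSquare_iff {ℓ : ℝ} (hℓ : 0 < ℓ) {F : Set Plane} :
    CoveredBy ℓ unitSquare F ↔
      ∃ c s α β : ℝ, c ^ 2 + s ^ 2 = 1 ∧ F ⊆ tiltedSquare c s α β ℓ := by
  constructor
  · rintro ⟨T, hT, h⟩
    obtain ⟨c, s, α, β, hcs, rfl⟩ := (mem_scaledCopies_unitSquare hℓ).1 hT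
    exact ⟨c, s, α, β, hcs, h⟩
  · rintro ⟨c, s, α, β, hcs, h⟩
    exact ⟨_, (mem_scaledCopies_unitSquare hℓ).2 ⟨c, s, α, β, hcs, rfl⟩, h⟩

/-- The line meets the left side of the square or misses its interior, so at most a corner is
folded, and m ≤ 1 keeps its image inside. -/
theorem halfFold_corner_subset {m d : ℝ} (hm : 0 ≤ m) (hm1 : m ≤ 1) (hd : d ≤ m) :
    halfFold 1 m d unitSquare ⊆ unitSquare := by
  rintro _ (⟨hx, -⟩ | ⟨x, ⟨hx, hl⟩, rfl⟩)
  · exact hx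
  obtain ⟨h1, h2, h3, h4⟩ := mem_unitSquare.1 hx
  obtain ⟨j, hj⟩ : ∃ j, j = 1 / (1 + m ^ 2) := ⟨_, rfl⟩
  have hj1 : j * (1 + m ^ 2) = 1 := by rw [hj]; field_simp
  have hj0 : 0 < j := by rw [hj]; positivity
  have e0 : mirror 1 m d x 0 = x 0 + j * (2 * (d - x 0 - m * x 1)) := by
    rw [mirror_zero, hj]; ring
  have e1 : mirror 1 m d x 1 = x 1 + j * (2 * (d - x 0 - m * x 1)) * m := by
    rw [mirror_one, hj]; ring
  have hl0 : 0 ≤ j * (2 * (d - x 0 - m * x 1)) := mul_nonneg hj0.le (by linarith)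
  have hmm : m * m ≤ m * 1 := mul_le_mul_of_nonneg_left hm1 hm
  rw [mem_unitSquare, e0, e1]
  refine ⟨by linarith, ?_, by linarith [mul_nonneg hl0 hm], ?_⟩
  · have a1 : x 0 * (1 + m ^ 2) + 2 * (d - x 0 - m * x 1) ≤ 1 + m ^ 2 := by
      linarith [mul_nonneg hm h3, mul_nonneg h1 (show 0 ≤ 1 - m * m by linarith),
        sq_nonneg (1 - m)]
    have := mul_le_mul_of_nonneg_left a1 hj0.le
    linear_combination this + (1 - x 0) * hj1
  · have a1 : x 1 * (1 + m ^ 2) + 2 * (d - x 0 - m * x 1) * m ≤ 1 + m ^ 2 := by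
      have := mul_le_mul_of_nonneg_right (show d - x 0 ≤ m by linarith) hm
      linarith [mul_nonneg (show 0 ≤ 1 - x 1 by linarith) (show 0 ≤ 1 - m * m by linarith)]
    have := mul_le_mul_of_nonneg_left a1 hj0.le
    linear_combination this + (1 - x 1) * hj1

/-- The extremal fold of the unit square for the parameters `m` and `q`. -/
noncomputable def extremalFold (m q : ℝ) : Set Plane := halfFold 1 m (q + m / 2) unitSquare

namespace IsExtremalParam

variable {ρ m₀ q₀ : ℝ}

theorem halfFold_covered (h : IsExtremalParam ρ m₀ q₀) {m d : ℝ} (hm : 0 ≤ m) (hm1 : m ≤ 1)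
    (hd : 2 * d ≤ 1 + m) :
    (∃ ℓ, 0 < ℓ ∧ ℓ < ρ ∧ CoveredBy ℓ unitSquare (halfFold 1 m d unitSquare)) ∨
      halfFold 1 m d unitSquare = extremalFold m₀ q₀ := by
  have hρ := h.rho_lb
  rcases le_total d m with hdm | hdm
  · refine Or.inl ⟨1, one_pos, by linarith, (coveredBy_unitSquare_iff one_pos).2
      ⟨1, 0, 0, 0, by norm_num, (halfFold_corner_subset hm hm1 hdm).trans fun p hp => ?_⟩⟩
    simpa [tiltedSquare] using mem_unitSquare.1 hp
  obtain ⟨t, ht⟩ : ∃ t, t = d - m := ⟨_, rfl⟩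
  obtain rfl : d = t + m := by linarith
  have ht0 : 0 ≤ t := by linarith
  have hmt : 2 * t + m ≤ 1 := by linarith
  obtain ⟨j, hj⟩ : ∃ j, j = 1 / (1 + m ^ 2) := ⟨_, rfl⟩
  have hj1 : j * (1 + m ^ 2) = 1 := by rw [hj]; field_simp
  have hj0 : 0 < j := by rw [hj]; positivity
  rcases lt_or_ge (1 + 2 * t * j * m) ρ with h0 | h0
  · have hpos : 0 < 1 + 2 * t * j * m := by positivity
    exact Or.inl ⟨_, hpos, h0, (coveredBy_unitSquare_iff hpos).2
      ⟨1, 0, t, 0, by norm_num, halfFold_subset_axis hm ht0 hmt hj1⟩⟩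
  have hm' : 0 < m := by
    refine lt_of_le_of_ne hm fun e => ?_
    rw [← e] at h0
    linarith
  by_cases hne : m = m₀ ∧ t + m / 2 = q₀
  · right
    obtain ⟨rfl, rfl⟩ := hne
    unfold extremalFold
    congr 1
    ring
  left
  -- The axis-parallel square having side at least ρ is exactly the height condition, which both
  -- remaining estimates need.
  have hc : ρ * m ^ 2 + (ρ - 1) ≤ 2 * (t + m / 2) * m := by
    have := mul_le_mul_of_nonneg_right h0 (show 0 ≤ 1 + m ^ 2 by positivity)
    linear_combination this + 2 * t * m * hj1
  rcases le_total q₀ (t + m / 2) with hq | hq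
  · have key := h.diag_lt hm' hm1 hq (by linarith) hc hne
    have hrp : 0 < t ^ 2 + (t + m) ^ 2 := by positivity
    have hr := Real.sq_sqrt hrp.le
    have hr0 := Real.sqrt_pos.2 hrp
    obtain ⟨r, hrd⟩ : ∃ r, r = √(t ^ 2 + (t + m) ^ 2) := ⟨_, rfl⟩
    rw [← hrd] at hr hr0
    have hN : 0 < t + (t + m) - t * (t + m) := by
      have : t * (t + m) ≤ 1 * (t + m) :=
        mul_le_mul_of_nonneg_right (by linarith) (by linarith)
      rcases ht0.eq_or_lt with e | e
      · rw [← e]; linarith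
      · linarith
    refine ⟨_, div_pos hN hr0, ?_, (coveredBy_unitSquare_iff (div_pos hN hr0)).2
      ⟨_, _, _, _, ?_, halfFold_subset_diag hm' ht0 hmt hj1 hr0⟩⟩
    · rw [div_lt_iff₀ hr0]
      refine lt_of_pow_lt_pow_left₀ 2 (by positivity) ?_
      rw [mul_pow, hr]
      linear_combination key
    · field_simp
      linarith
  · have key := h.flush_lt hm' hq hc hne
    obtain ⟨a, ha⟩ : ∃ a, a = 2 * t * m := ⟨_, rfl⟩
    obtain ⟨b, hb⟩ : ∃ b, b = 1 + m ^ 2 - 2 * t := ⟨_, rfl⟩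
    have hb0 : 0 < b := by
      have : 0 < m ^ 2 := by positivity
      linarith
    have ha0 : 0 ≤ a := by rw [ha]; positivity
    have hrp : 0 < a ^ 2 + b ^ 2 := by positivity
    have hr := Real.sq_sqrt hrp.le
    have hr0 := Real.sqrt_pos.2 hrp
    obtain ⟨r, hrd⟩ : ∃ r, r = √(a ^ 2 + b ^ 2) := ⟨_, rfl⟩
    rw [← hrd] at hr hr0
    have hN : 0 < a + b - a * (t + m) := by
      have : a * (t + m) ≤ a * 1 := mul_le_mul_of_nonneg_left (by linarith) ha0
      linarith
    refine ⟨_, div_pos hN hr0, ?_, (coveredBy_unitSquare_iff (div_pos hN hr0)).2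
      ⟨_, _, _, _, ?_, halfFold_subset_flush hm' ht0 hmt hj1 ha hb hr0⟩⟩
    · rw [div_lt_iff₀ hr0]
      refine lt_of_pow_lt_pow_left₀ 2 (by positivity) ?_
      rw [mul_pow, hr, ha, hb]
      linear_combination key
    · field_simp
      linarith

end IsExtremalParam

/-! ### Lower bound: directions of enclosing squares -/

/-- How the scalar product with `V` changes between two unit vectors. -/
theorem dot_sub_dot_mul {p₀ p₁ q₀ q₁ : ℝ} (v₀ v₁ : ℝ) (hp : p₀ ^ 2 + p₁ ^ 2 = 1)
    (hq : q₀ ^ 2 + q₁ ^ 2 = 1) :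
    (v₀ * p₀ + v₁ * p₁ - (v₀ * q₀ + v₁ * q₁)) * (1 + (p₀ * q₀ + p₁ * q₁)) =
      (q₀ * p₁ - q₁ * p₀) * ((p₀ + q₀) * v₁ - (p₁ + q₁) * v₀) := by
  -- For unit vectors, p - q is p + q turned by a right angle and scaled by the tangent of half the
  -- angle. So V·p - V·q is decided by the order of p and q and the side of their bisector on which
  -- V lies.
  linear_combination -(v₀ * p₀ + v₁ * p₁) * hq + (v₀ * q₀ + v₁ * q₁) * hp

theorem eq_of_cross_eq_zero {p₀ p₁ q₀ q₁ : ℝ} (hp : p₀ ^ 2 + p₁ ^ 2 = 1)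
    (hq : q₀ ^ 2 + q₁ ^ 2 = 1) (hp0 : 0 < p₀) (hq0 : 0 < q₀) (h : q₀ * p₁ - q₁ * p₀ = 0) :
    p₀ = q₀ ∧ p₁ = q₁ := by
  have e : p₀ ^ 2 = q₀ ^ 2 := by
    linear_combination -p₀ ^ 2 * hq + q₀ ^ 2 * hp - (q₀ * p₁ + q₁ * p₀) * h
  have e0 : p₀ = q₀ := (pow_left_inj₀ hp0.le hq0.le two_ne_zero).1 e
  refine ⟨e0, ?_⟩
  rw [e0] at h
  have : q₀ * (p₁ - q₁) = 0 := by linarith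
  rcases mul_eq_zero.1 this with h' | h' <;> linarith

/-- The directions in which all four chords of the extremal fold are at most `ρ` wide. -/
theorem direction_cases {ρ t d R c s c₁ s₁ c₂ s₂ : ℝ} (hρ : 1.1052 < ρ) (hρ' : ρ < 1.1053)
    (ht : 0.3479 < t) (hR : 0.679 < R) (hR' : R < 0.68)
    (hd : d < 0.5029) (hc : 0 < c) (hs : 0 ≤ s) (hcs : c ^ 2 + s ^ 2 = 1)
    (h1 : c₁ ^ 2 + s₁ ^ 2 = 1) (hc₁ : 0.56 < c₁) (hc₁' : c₁ < 0.58) (hs₁ : 0.81 < s₁)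
    (hs₁' : s₁ < 0.83)
    (h2 : c₂ ^ 2 + s₂ ^ 2 = 1) (hc₂ : 0.3 < c₂) (hc₂' : c₂ < 0.32) (hs₂ : 0.94 < s₂)
    (hv1 : c₁ + (1 - t) * s₁ = ρ) (hv2 : (1 - d) * c₁ + s₁ = ρ) (hv3 : (1 - d) * c₂ + s₂ = ρ)
    (hv4 : (R - d) * c₂ + ρ * s₂ = ρ)
    (w1 : (1 - R) * s + ρ * c ≤ ρ) (w2 : c + (1 - t) * s ≤ ρ) (w3 : (1 - d) * c + s ≤ ρ)
    (w4 : (R - d) * c + ρ * s ≤ ρ) :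
    (c = 1 ∧ s = 0) ∨ (c = c₁ ∧ s = s₁) ∨ (c = c₂ ∧ s = s₂) := by
  rcases hs.eq_or_lt with rfl | hs
  · left
    refine ⟨?_, rfl⟩
    have : c ^ 2 = 1 ^ 2 := by linarith
    exact (pow_left_inj₀ hc.le zero_le_one two_ne_zero).1 this
  right
  have hc1 : c ≤ 1 := by nlinarith
  have hs1 : s ≤ 1 := by nlinarith
  -- The chord BR excludes small positive angles: it bounds the tangent of half the angle from
  -- below.
  have hlow : (1 - R) * (1 + c) ≤ ρ * s := by
    refine le_of_mul_le_mul_left ?_ hs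
    have := mul_le_mul_of_nonneg_right w1 (show 0 ≤ 1 + c by linarith)
    linear_combination this - ρ * hcs
  have hlow' : 0.2895 * (1 + c) ≤ s := by
    have e1 : 0.32 * (1 + c) ≤ (1 - R) * (1 + c) :=
      mul_le_mul_of_nonneg_right (by linarith) (by linarith)
    have e2 : ρ * s ≤ 1.1053 * s := mul_le_mul_of_nonneg_right hρ'.le hs.le
    linarith
  -- From there up to the direction (c₁, s₁) the chord BD projects to more than ρ.
  have hx1 : 0 ≤ c₁ * s - s₁ * c := by
    by_contra! hneg
    have e := dot_sub_dot_mul 1 (1 - t) hcs h1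
    have e1 : (c + c₁) * (1 - t) - (s + s₁) * 1 < 0 := by
      have := mul_le_mul_of_nonneg_left (show 1 - t ≤ 0.6521 by linarith)
        (show 0 ≤ c + c₁ by linarith)
      linarith
    have e2 := mul_pos_of_neg_of_neg hneg e1
    have e3 : (1 * c + (1 - t) * s - (1 * c₁ + (1 - t) * s₁)) * (1 + (c * c₁ + s * s₁)) ≤ 0 :=
      mul_nonpos_of_nonpos_of_nonneg (by linarith) (by positivity)
    linarith
  rcases hx1.eq_or_lt with hx1 | hx1
  · exact Or.inl (eq_of_cross_eq_zero hcs h1 hc (by linarith) hx1.symm)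
  right
  -- AC projects to ρ in both directions (c₁, s₁) and (c₂, s₂), so it bisects them and is too long
  -- strictly between them.
  have hsum : (c₂ + c₁) * 1 - (s₂ + s₁) * (1 - d) = 0 := by
    have e := dot_sub_dot_mul (1 - d) 1 h2 h1
    have e1 : 0 < c₁ * s₂ - s₁ * c₂ := by
      have : 0.56 * 0.94 < c₁ * s₂ := mul_lt_mul'' hc₁ hs₂ (by norm_num) (by norm_num)
      have : s₁ * c₂ < 0.83 * 0.32 := mul_lt_mul'' hs₁' hc₂' (by linarith) (by linarith)
      linarith
    rw [show (1 - d) * c₂ + 1 * s₂ - ((1 - d) * c₁ + 1 * s₁) = 0 by linarith, zero_mul] at e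
    exact (mul_eq_zero.1 e.symm).resolve_left e1.ne'
  have hneg : (c + c₁) * 1 - (s + s₁) * (1 - d) ≤ 0 := by
    by_contra! hpos
    have e := dot_sub_dot_mul (1 - d) 1 hcs h1
    have e2 := mul_pos hx1 hpos
    have e3 : ((1 - d) * c + 1 * s - ((1 - d) * c₁ + 1 * s₁)) * (1 + (c * c₁ + s * s₁)) ≤ 0 :=
      mul_nonpos_of_nonpos_of_nonneg (by linarith) (by positivity)
    linarith
  have hneg2 : c₂ * 1 - s₂ * (1 - d) < 0 := by
    have : 0.94 * 0.4971 < s₂ * (1 - d) :=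
      mul_lt_mul'' hs₂ (by linarith) (by norm_num) (by norm_num)
    linarith
  have hx2 : 0 ≤ c₂ * s - s₂ * c := by
    by_contra! hlt
    have e := dot_sub_dot_mul (1 - d) 1 hcs h2
    have e1 : (c + c₂) * 1 - (s + s₂) * (1 - d) < 0 := by linarith
    have e2 := mul_pos_of_neg_of_neg hlt e1
    have e3 : ((1 - d) * c + 1 * s - ((1 - d) * c₂ + 1 * s₂)) * (1 + (c * c₂ + s * s₂)) ≤ 0 :=
      mul_nonpos_of_nonpos_of_nonneg (by linarith) (by positivity)
    linarith
  rcases hx2.eq_or_lt with hx2 | hx2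
  · exact eq_of_cross_eq_zero hcs h2 hc (by linarith) hx2.symm
  exfalso
  -- Likewise AR projects to ρ in the directions (c₂, s₂) and (0, 1), and to more between them; (0,
  -- 1) itself is excluded by c > 0.
  have hR2 : c₂ * ρ - s₂ * (R - d) = R - d := by
    have e := dot_sub_dot_mul (R - d) ρ h2 (show (0 : ℝ) ^ 2 + 1 ^ 2 = 1 by norm_num)
    rw [show (R - d) * c₂ + ρ * s₂ - ((R - d) * 0 + ρ * 1) = 0 by linarith, zero_mul] at e
    have := (mul_eq_zero.1 e.symm).resolve_left (by linarith)
    linarith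
  have e := dot_sub_dot_mul (R - d) ρ hcs h2
  have e1 : 0 < (c + c₂) * ρ - (s + s₂) * (R - d) := by
    have : 0 < c * ρ := mul_pos hc (by linarith)
    have : s * (R - d) ≤ 1 * (R - d) := mul_le_mul_of_nonneg_right hs1 (by linarith)
    linarith
  have e2 := mul_pos hx2 e1
  have e3 : ((R - d) * c + ρ * s - ((R - d) * c₂ + ρ * s₂)) * (1 + (c * c₂ + s * s₂)) ≤ 0 :=
    mul_nonpos_of_nonpos_of_nonneg (by linarith) (by positivity)
  linarith

theorem tiltedSquare_rotate (c s α β ℓ : ℝ) :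
    tiltedSquare c s α β ℓ = tiltedSquare (-s) c β (-α - ℓ) ℓ := by
  ext p
  constructor
  · rintro ⟨h1, h2, h3, h4⟩
    exact ⟨by linarith, by linarith, by linarith, by linarith⟩
  · rintro ⟨h1, h2, h3, h4⟩
    exact ⟨by linarith, by linarith, by linarith, by linarith⟩

/-- The sides of a square may be assumed to point into the closed first quadrant. -/
theorem tiltedSquare_quadrant {c s : ℝ} (α β ℓ : ℝ) (h : c ^ 2 + s ^ 2 = 1) :
    ∃ c' s' α' β', 0 < c' ∧ 0 ≤ s' ∧ c' ^ 2 + s' ^ 2 = 1 ∧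
      tiltedSquare c s α β ℓ = tiltedSquare c' s' α' β' ℓ := by
  have e1 := tiltedSquare_rotate c s α β ℓ
  have e2 := e1.trans (tiltedSquare_rotate _ _ _ _ _)
  have e3 := e2.trans (tiltedSquare_rotate _ _ _ _ _)
  rcases lt_trichotomy c 0 with hc | rfl | hc
  · rcases le_or_gt s 0 with hs | hs
    · exact ⟨-c, -s, _, _, by linarith, by linarith, by linarith, e2⟩
    · exact ⟨- -s, -c, _, _, by linarith, by linarith, by linarith, e3⟩
  · rcases lt_trichotomy s 0 with hs | rfl | hs
    · exact ⟨-s, 0, _, _, by linarith, le_rfl, by linarith, e1⟩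
    · norm_num at h
    · exact ⟨- -s, -0, _, _, by linarith, by linarith, by linarith, e3⟩
  · rcases le_or_gt 0 s with hs | hs
    · exact ⟨c, s, α, β, hc, hs, h, rfl⟩
    · exact ⟨-s, c, _, _, by linarith, hc.le, by linarith, e1⟩

/-- The corners of one square lie in the other, which has the same side. If x and y are the cosine
and sine of the angle between them, then x + y ≤ 1 and x - y ≤ 1 with x > 0, which forces y = 0. -/
theorem direction_eq_of_tiltedSquare_eq {c s α β c' s' α' β' ℓ : ℝ} (hℓ : 0 < ℓ)
    (hc : 0 < c) (hs : 0 ≤ s) (h : c ^ 2 + s ^ 2 = 1) (hc' : 0 < c') (hs' : 0 ≤ s')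
    (h' : c' ^ 2 + s' ^ 2 = 1)
    (he : tiltedSquare c s α β ℓ = tiltedSquare c' s' α' β' ℓ) : c = c' ∧ s = s' := by
  have hmem : ∀ x y : ℝ, 0 ≤ x → x ≤ ℓ → 0 ≤ y → y ≤ ℓ →
      !₂[c * (α + x) - s * (β + y), s * (α + x) + c * (β + y)] ∈
        tiltedSquare c' s' α' β' ℓ := by
    intro x y hx hx' hy hy'
    rw [← he]
    have e0 : c * (c * (α + x) - s * (β + y)) + s * (s * (α + x) + c * (β + y)) = α + x := by
      linear_combination (α + x) * h
    have e1 : -s * (c * (α + x) - s * (β + y)) + c * (s * (α + x) + c * (β + y)) = β + y := by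
      linear_combination (β + y) * h
    simp [tiltedSquare]
    exact ⟨by linarith, by linarith, by linarith, by linarith⟩
  have k00 := hmem 0 0 le_rfl hℓ.le le_rfl hℓ.le
  have k10 := hmem ℓ 0 hℓ.le le_rfl le_rfl hℓ.le
  have k01 := hmem 0 ℓ le_rfl hℓ.le hℓ.le le_rfl
  have k11 := hmem ℓ ℓ hℓ.le le_rfl hℓ.le le_rfl
  obtain ⟨x, hx⟩ : ∃ x, x = c' * c + s' * s := ⟨_, rfl⟩
  obtain ⟨y, hy⟩ : ∃ y, y = c' * s - s' * c := ⟨_, rfl⟩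
  have hxy : x ^ 2 + y ^ 2 = 1 := by
    rw [hx, hy]; linear_combination (c' ^ 2 + s' ^ 2) * h + h'
  simp only [tiltedSquare, Set.mem_ofPred_eq] at k00 k10 k01 k11
  simp at k00 k10 k01 k11
  have hx0 : 0 < x := by rw [hx]; positivity
  have b1 : x - y ≤ 1 := by
    refine le_of_mul_le_mul_left ?_ hℓ
    rw [hx, hy]; linarith [k00.1, k11.2.1]
  have b2 : x + y ≤ 1 := by
    refine le_of_mul_le_mul_left ?_ hℓ
    rw [hx, hy]; linarith [k01.1, k10.2.1]
  have hy0 : y = 0 := by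
    rcases lt_trichotomy y 0 with hlt | heq | hgt
    · nlinarith
    · exact heq
    · nlinarith
  exact eq_of_cross_eq_zero h h' hc hc' (by linarith)

theorem vadd_tiltedSquare (v : Plane) (c s α β ℓ : ℝ) : v +ᵥ tiltedSquare c s α β ℓ =
    tiltedSquare c s (α + (c * v 0 + s * v 1)) (β + (-s * v 0 + c * v 1)) ℓ := by
  ext p
  rw [Set.mem_vadd_set_iff_neg_vadd_mem]
  have e0 : (-v +ᵥ p) 0 = p 0 - v 0 := by simp; ring
  have e1 : (-v +ᵥ p) 1 = p 1 - v 1 := by simp; ring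
  simp only [tiltedSquare, Set.mem_ofPred_eq, e0, e1]
  constructor
  · rintro ⟨h1, h2, h3, h4⟩
    exact ⟨by linarith, by linarith, by linarith, by linarith⟩
  · rintro ⟨h1, h2, h3, h4⟩
    exact ⟨by linarith, by linarith, by linarith, by linarith⟩

theorem tiltedSquare_isTranslateOf (c s α β α' β' ℓ : ℝ) (h : c ^ 2 + s ^ 2 = 1) :
    IsTranslateOf (tiltedSquare c s α β ℓ) (tiltedSquare c s α' β' ℓ) := by
  refine ⟨!₂[c * (α - α') - s * (β - β'), s * (α - α') + c * (β - β')], ?_⟩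
  rw [vadd_tiltedSquare]
  congr 1
  · simp; linear_combination -(α - α') * h
  · simp; linear_combination -(β - β') * h

/-- The four chords of the fold that determine the minimum enclosing squares. -/
theorem chords_le {m t j c s α β ℓ : ℝ} (hm : 0 ≤ m) (ht : 0 ≤ t) (hmt : t + m ≤ 1)
    (hj : j = 1 / (1 + m ^ 2))
    (h : halfFold 1 m (t + m) unitSquare ⊆ tiltedSquare c s α β ℓ) :
    (1 - 2 * t * j) * s + (1 + 2 * t * j * m) * c ≤ ℓ ∧ c + (1 - t) * s ≤ ℓ ∧
      (1 - (t + m)) * c + s ≤ ℓ ∧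
      (2 * t * j - (t + m)) * c + (1 + 2 * t * j * m) * s ≤ ℓ := by
  have hS : ∀ x y : ℝ, 0 ≤ x → x ≤ 1 → 0 ≤ y → y ≤ 1 → (!₂[x, y] : Plane) ∈ unitSquare :=
    fun x y h1 h2 h3 h4 => mem_unitSquare.2 ⟨h1, h2, h3, h4⟩
  have hA := h (Or.inl ⟨hS (t + m) 0 (by linarith) hmt le_rfl zero_le_one, by simp⟩)
  have hB := h (Or.inl ⟨hS 1 0 zero_le_one le_rfl le_rfl zero_le_one, by simp; linarith⟩)
  have hC := h (Or.inl ⟨hS 1 1 zero_le_one le_rfl zero_le_one le_rfl, by simp; linarith⟩)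
  have hD := h (Or.inl ⟨hS t 1 ht (by linarith) zero_le_one le_rfl, by simp⟩)
  have hR := h (Or.inr ⟨!₂[0, 1], ⟨hS 0 1 le_rfl zero_le_one zero_le_one le_rfl, by simp; linarith⟩,
    rfl⟩)
  have e0 : mirror 1 m (t + m) !₂[0, 1] 0 = 2 * t * j := by simp [hj]; ring
  have e1 : mirror 1 m (t + m) !₂[0, 1] 1 = 1 + 2 * t * j * m := by simp [hj]; ring
  simp only [tiltedSquare, Set.mem_ofPred_eq, e0, e1] at hA hB hC hD hR
  simp at hA hB hC hD
  -- In this order the chords are BR and BD, measured along (-s, c), and AC and AR, measured along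
  -- (c, s).
  exact ⟨by linarith, by linarith, by linarith, by linarith⟩

set_option maxHeartbeats 1000000 in
/-- The fold for the extremal parameters has exactly three directions of enclosing squares of
minimal side length. -/
theorem IsExtremalParam.exists_directions {ρ m q : ℝ} (h : IsExtremalParam ρ m q) :
    ∃ u v : Fin 3 → ℝ, (∀ i, 0 < u i ∧ 0 ≤ v i ∧ u i ^ 2 + v i ^ 2 = 1) ∧ Function.Injective u ∧
      (∀ i, ∃ α β, extremalFold m q ⊆ tiltedSquare (u i) (v i) α β ρ) ∧
      ∀ c s α β ℓ : ℝ, c ^ 2 + s ^ 2 = 1 → extremalFold m q ⊆ tiltedSquare c s α β ℓ →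
        ρ ≤ ℓ ∧ (ℓ = ρ → ∃ i α' β',
          tiltedSquare c s α β ℓ = tiltedSquare (u i) (v i) α' β' ρ) := by
  have hρ2 := h.rho_sq_bounds
  obtain ⟨rl, ru, ml, mu, ql, qu, h0, h1, h2⟩ := h
  obtain ⟨t, ht⟩ : ∃ t, t = q - m / 2 := ⟨_, rfl⟩
  obtain rfl : q = t + m / 2 := by linarith
  have hE : extremalFold m (t + m / 2) = halfFold 1 m (t + m) unitSquare := by
    unfold extremalFold; congr 1; ring
  rw [hE]
  obtain ⟨j, hj⟩ : ∃ j, j = 1 / (1 + m ^ 2) := ⟨_, rfl⟩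
  have hj1 : j * (1 + m ^ 2) = 1 := by rw [hj]; field_simp
  have hm : 0 < m := by linarith
  have htl : 0.34796 < t := by linarith
  have htu : t < 0.348015 := by linarith
  have hmt : 2 * t + m ≤ 1 := by linarith
  have hm2 : 0.15481 ^ 2 < m ^ 2 := by gcongr
  have hm2' : m ^ 2 < 0.15482 ^ 2 := by gcongr
  have hjl : 0.97659 < j := by rw [hj, lt_div_iff₀ (by positivity)]; linarith
  have hju : j < 0.9766 := by rw [hj, div_lt_iff₀ (by positivity)]; linarith
  have hR : 1 + 2 * t * j * m = ρ := by linear_combination j * h0 + (ρ - 1) * hj1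
  have hR1 : 0.679 < 2 * t * j := by
    have : 0.34796 * 0.97659 < t * j := mul_lt_mul'' htl hjl (by norm_num) (by norm_num)
    linarith
  have hR2 : 2 * t * j < 0.68 := by
    have : t * j < 0.348015 * 0.9766 := mul_lt_mul'' htu hju (by linarith) (by linarith)
    linarith
  have hrp : 0 < t ^ 2 + (t + m) ^ 2 := by positivity
  have hr := Real.sq_sqrt hrp.le
  have hr0 := Real.sqrt_pos.2 hrp
  obtain ⟨r, hrd⟩ : ∃ r, r = √(t ^ 2 + (t + m) ^ 2) := ⟨_, rfl⟩
  rw [← hrd] at hr hr0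
  have hr1 : 0.611 < r := by
    refine lt_of_pow_lt_pow_left₀ 2 hr0.le ?_
    have : 0.34796 ^ 2 < t ^ 2 := by gcongr
    have : 0.50277 ^ 2 < (t + m) ^ 2 := by gcongr; linarith
    linarith
  have hr2 : r < 0.612 := by
    refine lt_of_pow_lt_pow_left₀ 2 (by norm_num) ?_
    have : t ^ 2 < 0.348015 ^ 2 := by gcongr
    have : (t + m) ^ 2 < 0.502835 ^ 2 := by gcongr; linarith
    linarith
  -- The squared equation of the parameters is undone here, both sides being nonnegative; similarly
  -- for `hM`.
  have hN : t + (t + m) - t * (t + m) = ρ * r := by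
    refine (pow_left_inj₀ ?_ (by positivity) two_ne_zero).1 ?_
    · have := mul_le_mul_of_nonneg_left (show t + m ≤ 1 by linarith) (show 0 ≤ t by linarith)
      linarith
    · rw [mul_pow, hr]; linear_combination h1
  obtain ⟨a, ha⟩ : ∃ a, a = 2 * t * m := ⟨_, rfl⟩
  obtain ⟨b, hb⟩ : ∃ b, b = 1 + m ^ 2 - 2 * t := ⟨_, rfl⟩
  have hal : 0.1077 < a := by
    have : 0.34796 * 0.15481 < t * m := mul_lt_mul'' htl ml (by norm_num) (by norm_num)
    linarith
  have hau : a < 0.1078 := by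
    have : t * m < 0.348015 * 0.15482 := mul_lt_mul'' htu mu (by linarith) hm.le
    linarith
  have hbl : 0.3279 < b := by linarith
  have hbu : b < 0.3281 := by linarith
  have hwp : 0 < a ^ 2 + b ^ 2 := by positivity
  have hw := Real.sq_sqrt hwp.le
  have hw0 := Real.sqrt_pos.2 hwp
  obtain ⟨w, hwd⟩ : ∃ w, w = √(a ^ 2 + b ^ 2) := ⟨_, rfl⟩
  rw [← hwd] at hw hw0
  have hw1 : 0.345 < w := by
    refine lt_of_pow_lt_pow_left₀ 2 hw0.le ?_
    have : 0.1077 ^ 2 < a ^ 2 := by gcongr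
    have : 0.3279 ^ 2 < b ^ 2 := by gcongr
    linarith
  have hw2 : w < 0.3455 := by
    refine lt_of_pow_lt_pow_left₀ 2 (by norm_num) ?_
    have : a ^ 2 < 0.1078 ^ 2 := by gcongr
    have : b ^ 2 < 0.3281 ^ 2 := by gcongr
    linarith
  have hM : a + b - a * (t + m) = ρ * w := by
    refine (pow_left_inj₀ ?_ (by positivity) two_ne_zero).1 ?_
    · have := mul_le_mul_of_nonneg_left (show t + m ≤ 1 by linarith) (show 0 ≤ a by linarith)
      linarith
    · rw [mul_pow, hw, ha, hb]; linear_combination h2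
  -- This says that C and R are at the same level in the direction (a, b).
  have ham : 2 * t * j * (a + b * m) = a := by
    rw [ha, hb]; linear_combination 2 * t * m * hj1
  have n1 : (t / r) ^ 2 + ((t + m) / r) ^ 2 = 1 := by field_simp; linarith
  have n2 : (a / w) ^ 2 + (b / w) ^ 2 = 1 := by field_simp; linarith
  have c1l : 0.56 < t / r := by rw [lt_div_iff₀ hr0]; linarith
  have c1u : t / r < 0.58 := by rw [div_lt_iff₀ hr0]; linarith
  have s1l : 0.81 < (t + m) / r := by rw [lt_div_iff₀ hr0]; linarith
  have s1u : (t + m) / r < 0.83 := by rw [div_lt_iff₀ hr0]; linarith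
  have c2l : 0.3 < a / w := by rw [lt_div_iff₀ hw0]; linarith
  have c2u : a / w < 0.32 := by rw [div_lt_iff₀ hw0]; linarith
  have s2l : 0.94 < b / w := by rw [lt_div_iff₀ hw0]; linarith
  have v1 : t / r + (1 - t) * ((t + m) / r) = ρ := by field_simp; linarith
  have v2 : (1 - (t + m)) * (t / r) + (t + m) / r = ρ := by field_simp; linarith
  have v3 : (1 - (t + m)) * (a / w) + b / w = ρ := by field_simp; linarith
  have v4 : (2 * t * j - (t + m)) * (a / w) + ρ * (b / w) = ρ := by
    have : (2 * t * j - (t + m)) * a + ρ * b = ρ * w := by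
      linear_combination hM + ham - b * hR
    field_simp; linarith
  refine ⟨![1, t / r, a / w], ![0, (t + m) / r, b / w], ?_, ?_, ?_, ?_⟩
  · intro i
    fin_cases i
    · simp
    · exact ⟨by simp; positivity, by simp; positivity, by simpa using n1⟩
    · exact ⟨by simp; positivity, by simp; positivity, by simpa using n2⟩
  · intro i k hik
    fin_cases i <;> fin_cases k <;> simp at hik ⊢ <;> linarith
  · intro i
    fin_cases i
    · refine ⟨t, 0, ?_⟩
      have := halfFold_subset_axis hm.le (by linarith) hmt hj1
      rw [hR] at this
      exact this
    · refine ⟨t * (t + m) / r, -(t + m) / r, ?_⟩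
      have := halfFold_subset_diag hm (by linarith) hmt hj1 hr0
      rw [hN, mul_div_cancel_right₀ _ hr0.ne'] at this
      exact this
    · refine ⟨a * (t + m) / w, -b / w, ?_⟩
      have := halfFold_subset_flush hm (by linarith) hmt hj1 ha hb hw0
      rw [hM, mul_div_cancel_right₀ _ hw0.ne'] at this
      exact this
  · intro c s α β ℓ hcs hsub
    obtain ⟨c', s', α', β', hc', hs', hcs', he⟩ := tiltedSquare_quadrant α β ℓ hcs
    rw [he] at hsub ⊢
    obtain ⟨w1, w2, w3, w4⟩ := chords_le hm.le (by linarith) (by linarith) hj hsub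
    rw [hR] at w1 w4
    have hcases : ℓ ≤ ρ → (c' = 1 ∧ s' = 0) ∨ (c' = t / r ∧ s' = (t + m) / r) ∨
        (c' = a / w ∧ s' = b / w) := fun hle =>
      direction_cases (ρ := ρ) (t := t) (d := t + m) (R := 2 * t * j) (by linarith) (by linarith)
        (by linarith) hR1 hR2 (by linarith) hc' hs' hcs' n1 c1l c1u s1l s1u n2 c2l
        c2u s2l v1 v2 v3 v4 (w1.trans hle) (w2.trans hle) (w3.trans hle) (w4.trans hle)
    constructor
    · by_contra! hlt
      -- In each of the three directions one of the four chords already has width ρ.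
      rcases hcases hlt.le with ⟨rfl, rfl⟩ | ⟨rfl, rfl⟩ | ⟨rfl, rfl⟩ <;> linarith
    · rintro rfl
      rcases hcases le_rfl with ⟨rfl, rfl⟩ | ⟨rfl, rfl⟩ | ⟨rfl, rfl⟩
      · exact ⟨0, α', β', rfl⟩
      · exact ⟨1, α', β', rfl⟩
      · exact ⟨2, α', β', rfl⟩

/-! ### Transport from the unit square to any square -/

theorem simMap_simMap {ε : ℝ} (κ c s b₀ b₁ κ' c' s' ε' b₀' b₁' : ℝ) (hε : ε ^ 2 = 1) (x : Plane) :
    simMap κ c s ε b₀ b₁ (simMap κ' c' s' ε' b₀' b₁' x) =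
      simMap (κ * κ') (c * c' - ε * s * s') (s * c' + ε * c * s') (ε * ε')
        (κ * (c * b₀' - ε * s * b₁') + b₀) (κ * (s * b₀' + ε * c * b₁') + b₁) x := by
  apply plane_ext
  · simp only [simMap_zero, simMap_one]
    linear_combination κ * κ' * ε' * c * s' * x 1 * hε
  · simp only [simMap_zero, simMap_one]
    linear_combination κ * κ' * ε' * s * s' * x 1 * hε

theorem scaledCopies_trans {k l : ℝ} {X Y Z : Set Plane} (h1 : X ∈ scaledCopies k Y)
    (h2 : Y ∈ scaledCopies l Z) : X ∈ scaledCopies (k * l) Z := by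
  rw [mem_scaledCopies_iff_simMap] at h1 h2 ⊢
  obtain ⟨c, s, ε, b₀, b₁, hcs, hε, rfl⟩ := h1
  obtain ⟨c', s', ε', b₀', b₁', hcs', hε', rfl⟩ := h2
  refine ⟨c * c' - ε * s * s', s * c' + ε * c * s', ε * ε',
    k * (c * b₀' - ε * s * b₁') + b₀, k * (s * b₀' + ε * c * b₁') + b₁, ?_, ?_, ?_⟩
  rotate_left 2
  · rw [Set.image_image]
    exact Set.image_congr fun x _ => simMap_simMap k c s b₀ b₁ l c' s' ε' b₀' b₁' hε x
  · linear_combination (c' ^ 2 + ε ^ 2 * s' ^ 2) * hcs + hcs' + s' ^ 2 * hε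
  · rw [mul_pow, hε, hε', one_mul]

theorem scaledCopies_symm {k : ℝ} (hk : k ≠ 0) {X Y : Set Plane} (h : X ∈ scaledCopies k Y) :
    Y ∈ scaledCopies k⁻¹ X := by
  obtain ⟨g, rfl⟩ := h
  have h1 : k • Y ∈ scaledCopies 1 (g '' (k • Y)) := by
    refine ⟨g.symm, ?_⟩
    rw [one_smul, Set.image_image]
    simp
  have h2 : Y ∈ scaledCopies k⁻¹ (k • Y) := by
    refine ⟨IsometryEquiv.refl _, ?_⟩
    rw [inv_smul_smul₀ hk]
    exact (Set.image_id Y).symm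
  simpa using scaledCopies_trans h2 h1

theorem isCongruentTo_iff_mem_scaledCopies {X Y : Set Plane} :
    IsCongruentTo X Y ↔ X ∈ scaledCopies 1 Y := by
  simp [IsCongruentTo, scaledCopies]

theorem simMap_bijective {κ c s ε : ℝ} (b₀ b₁ : ℝ) (hκ : κ ≠ 0) (h : c ^ 2 + s ^ 2 = 1)
    (hε : ε ^ 2 = 1) : Function.Bijective (simMap κ c s ε b₀ b₁) := by
  obtain ⟨g, hg⟩ := exists_isometryEquiv_eq_simMap b₀ b₁ h hε
  have e : simMap κ c s ε b₀ b₁ = g ∘ fun x => κ • x := by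
    funext x
    rw [Function.comp_apply, hg]
    apply plane_ext <;> simp <;> ring
  rw [e]
  exact g.bijective.comp (MulAction.bijective₀ hκ)

theorem convex_tiltedSquare (c s α β ℓ : ℝ) : Convex ℝ (tiltedSquare c s α β ℓ) := by
  intro x hx y hy u v hu hv huv
  obtain ⟨x1, x2, x3, x4⟩ := hx
  obtain ⟨y1, y2, y3, y4⟩ := hy
  have e0 : c * (u • x + v • y) 0 + s * (u • x + v • y) 1 =
    u * (c * x 0 + s * x 1) + v * (c * y 0 + s * y 1) := by simp; ring
  have e1 : -s * (u • x + v • y) 0 + c * (u • x + v • y) 1 =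
    u * (-s * x 0 + c * x 1) + v * (-s * y 0 + c * y 1) := by simp; ring
  have hI : ∀ {l r p q : ℝ}, l ≤ p → p ≤ r → l ≤ q → q ≤ r → l ≤ u * p + v * q ∧
      u * p + v * q ≤ r := fun h1 h2 h3 h4 => convex_Icc _ _ ⟨h1, h2⟩ ⟨h3, h4⟩ hu hv huv
  refine ⟨?_, ?_, ?_, ?_⟩
  · rw [e0]; exact (hI x1 x2 y1 y2).1
  · rw [e0]; exact (hI x1 x2 y1 y2).2
  · rw [e1]; exact (hI x3 x4 y3 y4).1
  · rw [e1]; exact (hI x3 x4 y3 y4).2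

theorem coveredBy_unitSquare_mono {ℓ ℓ' : ℝ} (hℓ : 0 < ℓ) (h : ℓ ≤ ℓ') {F : Set Plane}
    (hF : CoveredBy ℓ unitSquare F) : CoveredBy ℓ' unitSquare F := by
  obtain ⟨c, s, α, β, hcs, hsub⟩ := (coveredBy_unitSquare_iff hℓ).1 hF
  refine (coveredBy_unitSquare_iff (hℓ.trans_le h)).2 ⟨c, s, α, β, hcs, hsub.trans ?_⟩
  rintro p ⟨h1, h2, h3, h4⟩
  exact ⟨h1, by linarith, h3, by linarith⟩

section transport

variable {a c s ε b₀ b₁ : ℝ}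

theorem simMap_image_mem_scaledCopies (h : c ^ 2 + s ^ 2 = 1) (hε : ε ^ 2 = 1) (X : Set Plane) :
    simMap a c s ε b₀ b₁ '' X ∈ scaledCopies a X :=
  mem_scaledCopies_iff_simMap.2 ⟨c, s, ε, b₀, b₁, h, hε, rfl⟩

/-- Conjugating by a similarity of ratio a multiplies the factor by a and by 1/a, so covering
factors do not change. -/
theorem coveredBy_simMap_image_iff (ha : 0 < a) (h : c ^ 2 + s ^ 2 = 1) (hε : ε ^ 2 = 1)
    {ℓ : ℝ} {S G : Set Plane} :
    CoveredBy ℓ (simMap a c s ε b₀ b₁ '' S) (simMap a c s ε b₀ b₁ '' G) ↔ CoveredBy ℓ S G := by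
  have hT : ∀ X, simMap a c s ε b₀ b₁ '' X ∈ scaledCopies a X :=
    simMap_image_mem_scaledCopies h hε
  have hb := simMap_bijective b₀ b₁ ha.ne' h hε
  constructor
  · rintro ⟨Q, hQ, hsub⟩
    refine ⟨simMap a c s ε b₀ b₁ ⁻¹' Q, ?_, Set.image_subset_iff.1 hsub⟩
    have h1 := scaledCopies_symm ha.ne' (hT (simMap a c s ε b₀ b₁ ⁻¹' Q))
    rw [Set.image_preimage_eq _ hb.2] at h1
    have := scaledCopies_trans h1 (scaledCopies_trans hQ (hT S))
    rwa [show a⁻¹ * (ℓ * a) = ℓ by field_simp] at this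
  · rintro ⟨Q, hQ, hsub⟩
    refine ⟨simMap a c s ε b₀ b₁ '' Q, ?_, Set.image_mono hsub⟩
    have := scaledCopies_trans (hT Q) (scaledCopies_trans hQ (scaledCopies_symm ha.ne' (hT S)))
    rwa [show a * (ℓ * a⁻¹) = ℓ by field_simp] at this

theorem isCongruentTo_simMap_image (ha : 0 < a) (h : c ^ 2 + s ^ 2 = 1) (hε : ε ^ 2 = 1)
    {X Y : Set Plane} (hXY : IsCongruentTo X Y) :
    IsCongruentTo (simMap a c s ε b₀ b₁ '' X) (simMap a c s ε b₀ b₁ '' Y) := by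
  rw [isCongruentTo_iff_mem_scaledCopies] at hXY ⊢
  have hT : ∀ X, simMap a c s ε b₀ b₁ '' X ∈ scaledCopies a X :=
    simMap_image_mem_scaledCopies h hε
  have := scaledCopies_trans (hT X) (scaledCopies_trans hXY (scaledCopies_symm ha.ne' (hT Y)))
  rwa [one_mul, mul_inv_cancel₀ ha.ne'] at this

theorem isTranslateOf_simMap_image_iff (ha : 0 < a) (h : c ^ 2 + s ^ 2 = 1) (hε : ε ^ 2 = 1)
    {X Y : Set Plane} :
    IsTranslateOf (simMap a c s ε b₀ b₁ '' X) (simMap a c s ε b₀ b₁ '' Y) ↔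
      IsTranslateOf X Y := by
  have hb := simMap_bijective b₀ b₁ ha.ne' h hε
  have key : ∀ w x : Plane, simMap a c s ε b₀ b₁ (w +ᵥ x) =
      (simMap a c s ε b₀ b₁ w - simMap a c s ε b₀ b₁ 0) +ᵥ simMap a c s ε b₀ b₁ x := by
    intro w x
    apply plane_ext <;> simp <;> ring
  have himg : ∀ (w : Plane) (Z : Set Plane), simMap a c s ε b₀ b₁ '' (w +ᵥ Z) =
      (simMap a c s ε b₀ b₁ w - simMap a c s ε b₀ b₁ 0) +ᵥ (simMap a c s ε b₀ b₁ '' Z) := by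
    intro w Z
    rw [← Set.image_vadd, ← Set.image_vadd, Set.image_image, Set.image_image]
    exact Set.image_congr fun x _ => key w x
  constructor
  · rintro ⟨v, hv⟩
    obtain ⟨w, hw⟩ := hb.2 (v + simMap a c s ε b₀ b₁ 0)
    refine ⟨w, hb.1.image_injective ?_⟩
    rw [hv, himg, hw, add_sub_cancel_right]
  · rintro ⟨w, rfl⟩
    exact ⟨_, himg w Y⟩

end transport

/-! ### The main theorem -/

theorem mainTheorem3 :
    ∃ ϱ : ℝ,
      -- `ϱ` is the only positive real root of `Φ`
      (0 < ϱ ∧ Phi.IsRoot ϱ ∧ ∀ x : ℝ, 0 < x → Phi.IsRoot x → x = ϱ) ∧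
      -- `ϱ ≈ 1.105224`, correctly rounded to six decimals
      |ϱ - 1.105224| < 0.0000005 ∧
      -- for every square `S`, of any side length `a` and in any position
      ∀ (a : ℝ) (S : Set Plane), IsSquareOfSide a S →
        oneFoldCoverFactor S = ENNReal.ofReal ϱ ∧
        -- there is an extremal fold `F`, unique up to congruence, and up to translation
        -- it has exactly three minimum enclosing squares, all of side `ϱ * a`
        ∃ F : Set Plane, IsExtremalFold S F ∧
          (∀ F' : Set Plane, IsExtremalFold S F' → ∃ g : Plane ≃ᵢ Plane, F' = g '' F) ∧
          ∃ σ : Fin 3 → Set Plane,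
            (∀ i, IsMinEnclosingSquare (ϱ * a) F (σ i)) ∧
            (∀ i j, i ≠ j → ¬ IsTranslateOf (σ i) (σ j)) ∧
            (∀ (s : ℝ) (Q : Set Plane), IsMinEnclosingSquare s F Q →
              ∃ i, IsTranslateOf Q (σ i)) := by
  obtain ⟨ρ, m, q, hroot, h⟩ := exists_isExtremalParam
  have hρ : 0 < ρ := by linarith [h.rho_lb]
  refine ⟨ρ, ⟨hρ, hroot, fun x hx hxr => Phi_root_unique hx hρ hxr hroot⟩, ?_, ?_⟩
  · have := h.rho_lb
    have := h.rho_ub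
    rw [abs_lt]
    constructor <;> linarith
  rintro a S ⟨ha, hS⟩
  obtain ⟨u, v, huv, hinj, hcov, hmin⟩ := h.exists_directions
  obtain ⟨c, s, ε, b₀, b₁, hcs, hε, hST⟩ := mem_scaledCopies_iff_simMap.1 hS
  obtain ⟨T, hTdef⟩ : ∃ T : Plane → Plane, T = simMap a c s ε b₀ b₁ := ⟨_, rfl⟩
  have hSconv : Convex ℝ S := by
    obtain ⟨_, _, _, _, -, rfl⟩ := (mem_scaledCopies_unitSquare ha).1 hS
    exact convex_tiltedSquare _ _ _ _ _
  have hT : ∀ X, T '' X ∈ scaledCopies a X := by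
    rw [hTdef]; exact simMap_image_mem_scaledCopies hcs hε
  have hbij : Function.Bijective T := by rw [hTdef]; exact simMap_bijective b₀ b₁ ha.ne' hcs hε
  have hcovT : ∀ (ℓ : ℝ) (G : Set Plane), CoveredBy ℓ S (T '' G) ↔ CoveredBy ℓ unitSquare G := by
    intro ℓ G
    rw [hTdef, hST]; exact coveredBy_simMap_image_iff ha hcs hε
  have htransT : ∀ X Y, IsTranslateOf (T '' X) (T '' Y) ↔ IsTranslateOf X Y := by
    rw [hTdef]; exact fun _ _ => isTranslateOf_simMap_image_iff ha hcs hε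
  have hq : 0 < q + m / 2 := by linarith [h.q_lb, h.m_lb]
  have hfold : T '' extremalFold m q ∈ singleFolds S := by
    have hn : (c * 1 - ε * s * m) ^ 2 + (s * 1 + ε * c * m) ^ 2 = 1 + m ^ 2 := by
      linear_combination (1 + ε ^ 2 * m ^ 2) * hcs + m ^ 2 * hε
    rw [extremalFold, hTdef, ← simMap_image_halfFold b₀ b₁ 1 m _ ha hcs hε, ← hST]
    refine halfFold_mem_singleFolds hSconv (by rw [hn]; positivity) (x := T 0) ?_ ?_
    · rw [hST, ← hTdef]
      exact ⟨0, mem_unitSquare.2 (by simp), rfl⟩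
    · have : 0 < a * (q + m / 2) := mul_pos ha hq
      rw [hTdef]
      simp
      linarith
  have hlow : ∀ ℓ, 0 < ℓ → CoveredBy ℓ S (T '' extremalFold m q) → ρ ≤ ℓ := by
    intro ℓ hℓ hc
    obtain ⟨c', s', α, β, hcs', hsub⟩ := (coveredBy_unitSquare_iff hℓ).1 ((hcovT _ _).1 hc)
    exact (hmin _ _ _ _ _ hcs' hsub).1
  have hup : CoveredBy ρ S (T '' extremalFold m q) := by
    obtain ⟨α, β, hsub⟩ := hcov 0
    exact (hcovT _ _).2 ((coveredBy_unitSquare_iff hρ).2 ⟨_, _, α, β, (huv 0).2.2, hsub⟩)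
  -- The strict inequality in the first alternative is what makes the extremal fold unique.
  have hall : ∀ F ∈ singleFolds S, (∃ ℓ, 0 < ℓ ∧ ℓ < ρ ∧ CoveredBy ℓ S F) ∨
      IsCongruentTo F (T '' extremalFold m q) := by
    intro F hF
    obtain ⟨a', b', d', hab, rfl | rfl⟩ := singleFolds_cases hSconv hF
    · obtain ⟨x, hx⟩ : ∃ x, x = c * a' + s * b' := ⟨_, rfl⟩
      obtain ⟨y, hy⟩ : ∃ y, y = ε * (c * b' - s * a') := ⟨_, rfl⟩
      have e1 : c * x - ε * s * y = a' := by
        rw [hx, hy]; linear_combination a' * hcs - s * (c * b' - s * a') * hε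
      have e2 : s * x + ε * c * y = b' := by
        rw [hx, hy]; linear_combination b' * hcs + c * (c * b' - s * a') * hε
      have hxy : 0 < x ^ 2 + y ^ 2 := by
        have : x ^ 2 + y ^ 2 = a' ^ 2 + b' ^ 2 := by
          rw [hx, hy]
          linear_combination (a' ^ 2 + b' ^ 2) * hcs + (c * b' - s * a') ^ 2 * hε
        linarith
      have himg := simMap_image_halfFold b₀ b₁ x y ((d' - (a' * b₀ + b' * b₁)) / a) ha hcs hε
        unitSquare
      rw [e1, e2, mul_div_cancel₀ _ ha.ne', sub_add_cancel, ← hST, ← hTdef] at himg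
      rw [himg]
      obtain ⟨n, d, hn0, hn1, hd, hcong⟩ :=
        halfFold_congruent_normal ((d' - (a' * b₀ + b' * b₁)) / a) hxy
      rcases h.halfFold_covered hn0 hn1 hd with ⟨ℓ, h1, h2, h3⟩ | he
      · exact Or.inl ⟨ℓ, h1, h2, (hcovT _ _).2 (hcong.coveredBy h3)⟩
      · rw [he] at hcong
        rw [hTdef]
        exact Or.inr (isCongruentTo_simMap_image ha hcs hε hcong)
    · obtain ⟨g, hg⟩ := exists_isometryEquiv_eq_mirror d' hab
      refine Or.inl ⟨1, one_pos, by linarith [h.rho_lb], _, ⟨g, rfl⟩, ?_⟩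
      rw [one_smul, funext hg]
  have hmono : ∀ ℓ F, 0 < ℓ → ℓ ≤ ρ → CoveredBy ℓ S F → CoveredBy ρ S F := by
    intro ℓ F hℓ hle hc
    rw [← Set.image_preimage_eq F hbij.2, hcovT] at hc ⊢
    exact coveredBy_unitSquare_mono hℓ hle hc
  have hfactor : oneFoldCoverFactor S = ENNReal.ofReal ρ := by
    apply le_antisymm
    · refine iInf₂_le ρ ⟨hρ, fun F hF => ?_⟩
      rcases hall F hF with ⟨ℓ, h1, h2, h3⟩ | hcong
      · exact hmono ℓ F h1 h2.le h3
      · exact hcong.coveredBy hup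
    · exact le_iInf₂ fun ℓ hℓ => ENNReal.ofReal_le_ofReal (hlow ℓ hℓ.1 (hℓ.2 _ hfold))
  -- The square `Q` is pulled back along `T` to a square of side ℓ/a around the extremal fold of the
  -- unit square.
  have hlowsq : ∀ ℓ Q, IsSquareOfSide ℓ Q → T '' extremalFold m q ⊆ Q → ρ * a ≤ ℓ ∧
      (ℓ = ρ * a → ∃ i α β, Q = T '' tiltedSquare (u i) (v i) α β ρ) := by
    rintro ℓ Q ⟨hℓ, hQ⟩ hsub
    have h1 := scaledCopies_symm ha.ne' (hT (T ⁻¹' Q))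
    rw [Set.image_preimage_eq _ hbij.2] at h1
    have h2 := scaledCopies_trans h1 hQ
    have hℓa : 0 < a⁻¹ * ℓ := mul_pos (inv_pos.2 ha) hℓ
    obtain ⟨c', s', α, β, hcs', he⟩ := (mem_scaledCopies_unitSquare hℓa).1 h2
    have hsub' := Set.image_subset_iff.1 hsub
    rw [he] at hsub'
    obtain ⟨h3, h4⟩ := hmin _ _ _ _ _ hcs' hsub'
    refine ⟨?_, fun hle => ?_⟩
    · have := mul_le_mul_of_nonneg_right h3 ha.le
      rwa [show a⁻¹ * ℓ * a = ℓ by field_simp] at this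
    · obtain ⟨i, α', β', h5⟩ := h4 (by rw [hle]; field_simp)
      exact ⟨i, α', β', by rw [← h5, ← he, Set.image_preimage_eq _ hbij.2]⟩
  refine ⟨hfactor, T '' extremalFold m q, ⟨hfold, fun ℓ hℓ hc => ?_⟩, fun F' hF' => ?_, ?_⟩
  · rw [hfactor]
    exact ENNReal.ofReal_le_ofReal (hlow ℓ hℓ hc)
  · rcases hall F' hF'.1 with ⟨ℓ, h1, h2, h3⟩ | hcong
    · have := hF'.2 ℓ h1 h3
      rw [hfactor, ENNReal.ofReal_le_ofReal_iff h1.le] at this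
      linarith
    · exact hcong
  choose α β hsub using hcov
  have hσ : ∀ i, IsSquareOfSide (ρ * a) (T '' tiltedSquare (u i) (v i) (α i) (β i) ρ) := by
    intro i
    refine ⟨mul_pos hρ ha, ?_⟩
    rw [mul_comm]
    exact scaledCopies_trans (hT _)
      ((mem_scaledCopies_unitSquare hρ).2 ⟨_, _, _, _, (huv i).2.2, rfl⟩)
  refine ⟨fun i => T '' tiltedSquare (u i) (v i) (α i) (β i) ρ, fun i => ⟨hσ i,
    Set.image_mono (hsub i), fun s' Q' hQ' hF => (hlowsq s' Q' hQ' hF).1⟩, ?_, ?_⟩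
  · intro i k hik htr
    obtain ⟨w, hw⟩ := (htransT _ _).1 htr
    rw [vadd_tiltedSquare] at hw
    exact hik (hinj (direction_eq_of_tiltedSquare_eq hρ (huv i).1 (huv i).2.1 (huv i).2.2
      (huv k).1 (huv k).2.1 (huv k).2.2 hw).1)
  · rintro s' Q ⟨hQ, hFQ, hQmin⟩
    have hle := hQmin _ _ (hσ 0) (Set.image_mono (hsub 0))
    obtain ⟨hge, heq⟩ := hlowsq s' Q hQ hFQ
    obtain ⟨i, α', β', rfl⟩ := heq (le_antisymm hle hge)
    exact ⟨i, (htransT _ _).2 (tiltedSquare_isTranslateOf _ _ _ _ _ _ _ (huv i).2.2)⟩
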